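/- **Setting.** Let $\mathcal X\subseteq\mathbb R^d$ be compact, let $\sigma:\mathbb R\to\mathbb R$ be Lipschitz, and let $\mathcal U$ be a boundedly supported probability distribution on $\mathbb R^d$. For $U=(u_1,\dots,u_m)\in\mathbb R^{d\times m}$ and $\theta\in\mathbb R^m$ put $$\phi^{(U)}(x)=\bigl(\sigma(\langle u_i,x\rangle)\bigr)_{i=1}^m,\qquad f^{(U)}_\theta(x)=\tfrac1{\sqrt m}\langle\theta,\phi^{(U)}(x)\rangle,\qquad \ell(f;x,y)=\tfrac12(f(x)-y)^2 .$$ A *data distribution* $D$ is a probability distribution on $\mathcal X\times\mathbb R$ whose input marginal $D_{\mathrm x}$ has a density with respect to Lebesgue measure on $\mathcal X$ that is continuous on $\mathcal X$. It has *no label noise*, with target $f^*_D$, if $y=f^*_D(x)$ for $D$-almost every $(x,y)$. Fix a data distribution $D_{\mathrm{val}}$ and write $\mathcal L_D(f)=\mathbb E_{(x,y)\sim D}[\ell(f;x,y)]$ and $\mathcal L_{\mathrm{val}}=\mathcal L_{D_{\mathrm{val}}}$. *Training.* Draw $u_1,\dots,u_m$ independently from $\mathcal U$ and freeze them. Starting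 from $\theta_0=0$, run $$\theta_{t+1}=\theta_t-\frac{\eta}{B}\sum_{b=1}^{B}\nabla_\theta\,\ell\bigl(f^{(U)}_\theta;x_{t,b},y_{t,b}\bigr)\Big|_{\theta=\theta_t},$$ where the samples $(x_{t,b},y_{t,b})$ are drawn independently from $D$, independently of $U$. Let $\mathcal P^{(m)}(D;\eta,B,T)$ be the law of $(\theta_T,U)$, and let $$\mathcal I^{(m)}_{\mathrm{val}}(D;\eta,B,T)=\mathbb E_{(\theta,U)\sim\mathcal P^{(m)}(D;\eta,B,T)}\bigl[\mathcal L_{\mathrm{val}}(f^{(U)}_\theta)\bigr].$$ *Well-behaved distributions.* A data distribution $D$ without label noise, with target $f^*_D$, is *well-behaved* if: 1. $D_{\mathrm x}$ has a density on $\mathcal X$ that is continuous and strictly positive on $\mathcal X$. 2. The kernel $K(x,x')=\mathbb E_{u\sim\mathcal U}[\sigma(\langle u,x\rangle)\sigma(\langle u,x'\rangle)]$ is positive definite on $L^2(D_{\mathrm x})$: every eigenvalue of the integral operator $g\mapsto\int K(\cdot,x')g(x')\,dD_{\mathrm x}(x')$ on $L^2(D_{\mathrm x})$ is strictly positive. 3.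 There is a measurable function $\nu$, bounded on $\mathrm{supp}(\mathcal U)$, with $f^*_D(x)=\mathbb E_{u\sim\mathcal U}[\sigma(\langle u,x\rangle)\nu(u)]$ for all $x\in\mathcal X$. 4. For every batch size $B\ge1$ there are learning rates $\eta_{\mathrm{opt}}^{(m)}(D;B,T)$ which, for all sufficiently large $m$ and then all sufficiently large $T$ (how large may depend on $m$), minimize $\eta\mapsto\mathcal I_{\mathrm{val}}^{(m)}(D;\eta,B,T)$ over $\eta>0$, and such that $$\lim_{m\to\infty}\lim_{T\to\infty}\mathbb E_{(\theta,U)\sim\mathcal P^{(m)}(D;\eta_{\mathrm{opt}}^{(m)}(D;B,T),B,T)}\bigl[\mathcal L_D(f^{(U)}_\theta)\bigr]=0,$$ where the inner limit exists for all sufficiently large $m$. **Theorem.** Let $D_{\mathrm A}$ and $D_{\mathrm B}$ be two well-behaved data distributions without label noise, and assume that their best achievable validation losses differ: $$\Delta_{\mathrm{AB}}:=\mathcal L_{\mathrm{val}}(f^*_{D_{\mathrm A}})-\mathcal L_{\mathrm{val}}(f^*_{D_{\mathrm B}})\neq0 .$$ Then there exist constants $m_0,T_0,c_0,\alpha,\eta_{\max}>0$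 such that for all integers $m\ge m_0$, $T\ge T_0$, $B\ge1$ and all $\eta$ with $\frac{c_0}{T}\le\eta\le\min\{\alpha Bm,\eta_{\max}\}$, $$\mathrm{sign}\Bigl(\mathcal I^{(m)}_{\mathrm{val}}(D_{\mathrm A};\eta,B,T)-\mathcal I^{(m)}_{\mathrm{val}}(D_{\mathrm B};\eta,B,T)\Bigr)=\mathrm{sign}(\Delta_{\mathrm{AB}}).$$ -/

import Mathlib

open MeasureTheory Filter Topology
open scoped NNReal ENNReal

noncomputable section

namespace RandomFeature

/-! ### Two-layer random feature networks -/

/-- The random features `φ^{(U)}_i(x) = σ(⟨u_i, x⟩)`, for first-layer weights `U = (u_1, …, u_m)`. -/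
def featureMap {d m : ℕ} (σ : ℝ → ℝ) (U : Fin m → EuclideanSpace ℝ (Fin d))
    (x : EuclideanSpace ℝ (Fin d)) : EuclideanSpace ℝ (Fin m) :=
  WithLp.toLp 2 fun i => σ (inner ℝ (U i) x)

/-- The network output `f^{(U)}_θ(x) = ⟨θ, φ^{(U)}(x)⟩ / √m`. -/
def network {d m : ℕ} (σ : ℝ → ℝ) (U : Fin m → EuclideanSpace ℝ (Fin d))
    (θ : EuclideanSpace ℝ (Fin m)) (x : EuclideanSpace ℝ (Fin d)) : ℝ :=
  1 / Real.sqrt (m : ℝ) * inner ℝ θ (featureMap σ U x)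

/-- The squared loss `ℓ(f; x, y) = (f(x) - y)² / 2` at a sample `z = (x, y)`. -/
def sampleLoss {d : ℕ} (f : EuclideanSpace ℝ (Fin d) → ℝ)
    (z : EuclideanSpace ℝ (Fin d) × ℝ) : ℝ :=
  1 / 2 * (f z.1 - z.2) ^ 2

/-- The expected squared loss of a predictor `f` under a distribution `D` of samples `(x, y)`. -/
def expectedLoss {d : ℕ} (D : Measure (EuclideanSpace ℝ (Fin d) × ℝ))
    (f : EuclideanSpace ℝ (Fin d) → ℝ) : ℝ :=
  ∫ z, sampleLoss f z ∂D

/-! ### Data distributions -/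

/-- The marginal distribution `D_x` of the inputs. -/
def inputMarginal {d : ℕ} (D : Measure (EuclideanSpace ℝ (Fin d) × ℝ)) :
    Measure (EuclideanSpace ℝ (Fin d)) :=
  D.map Prod.fst

/-- `p` is a density on `X` (with respect to Lebesgue measure), continuous on `X`, of the
input marginal of `D`; in particular `D_x` is carried by `X`. -/
def HasContinuousDensity {d : ℕ} (X : Set (EuclideanSpace ℝ (Fin d)))
    (D : Measure (EuclideanSpace ℝ (Fin d) × ℝ)) (p : EuclideanSpace ℝ (Fin d) → ℝ≥0) : Prop :=
  ContinuousOn p X ∧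
    inputMarginal D = (volume.restrict X).withDensity fun x => (p x : ℝ≥0∞)

/-- A data distribution over `X × ℝ`: a probability distribution whose input marginal has a
continuous density over `X`. -/
structure IsDataDistribution {d : ℕ} (X : Set (EuclideanSpace ℝ (Fin d)))
    (D : Measure (EuclideanSpace ℝ (Fin d) × ℝ)) : Prop where
  isProbabilityMeasure : IsProbabilityMeasure D
  exists_density : ∃ p, HasContinuousDensity X D p

/-- `D` has no label noise, with target function `f`. -/
def IsNoiseFreeTarget {d : ℕ} (D : Measure (EuclideanSpace ℝ (Fin d) × ℝ))
    (f : EuclideanSpace ℝ (Fin d) → ℝ) : Prop :=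
  ∀ᵐ z ∂D, z.2 = f z.1

/-! ### Training with one-pass mini-batch SGD -/

/-- One SGD step on the second layer, with learning rate `η` and a batch of `B` samples. -/
def sgdStep {d m B : ℕ} (σ : ℝ → ℝ) (U : Fin m → EuclideanSpace ℝ (Fin d)) (η : ℝ)
    (batch : Fin B → EuclideanSpace ℝ (Fin d) × ℝ) (θ : EuclideanSpace ℝ (Fin m)) :
    EuclideanSpace ℝ (Fin m) :=
  θ - (η / (B : ℝ)) • ∑ b, gradient (fun θ' => sampleLoss (network σ U θ') (batch b)) θ

/-- The SGD iterates `θ_0 = 0, θ_1, θ_2, …` for a given stream of batches. -/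
def sgdIterate {d m B : ℕ} (σ : ℝ → ℝ) (U : Fin m → EuclideanSpace ℝ (Fin d)) (η : ℝ)
    (batches : ℕ → Fin B → EuclideanSpace ℝ (Fin d) × ℝ) : ℕ → EuclideanSpace ℝ (Fin m)
  | 0 => 0
  | t + 1 => sgdStep σ U η (batches t) (sgdIterate σ U η batches t)

/-- The law of an infinite stream of batches of `B` independent samples from `D`. -/
def batchStreamLaw {d : ℕ} (D : Measure (EuclideanSpace ℝ (Fin d) × ℝ)) (B : ℕ) :
    Measure (ℕ → Fin B → EuclideanSpace ℝ (Fin d) × ℝ) :=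
  Measure.infinitePi fun _ : ℕ => Measure.pi fun _ : Fin B => D

/-- The law of `(θ_T, U)`: the columns of `U` are independent draws from `𝓤`, the samples are
independent draws from `D`, independent of `U`, and `θ_T` is the result of `T` SGD steps. -/
def trainedLaw {d : ℕ} (σ : ℝ → ℝ) (𝓤 : Measure (EuclideanSpace ℝ (Fin d)))
    (D : Measure (EuclideanSpace ℝ (Fin d) × ℝ)) (m : ℕ) (η : ℝ) (B T : ℕ) :
    Measure (EuclideanSpace ℝ (Fin m) × (Fin m → EuclideanSpace ℝ (Fin d))) :=
  ((Measure.pi fun _ : Fin m => 𝓤).prod (batchStreamLaw D B)).map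
    fun ω => (sgdIterate σ ω.1 η ω.2 T, ω.1)

/-- The expectation, over the trained network `(θ_T, U)`, of its loss under the distribution
`Deval`. -/
def expectedTrainedLoss {d : ℕ} (σ : ℝ → ℝ) (𝓤 : Measure (EuclideanSpace ℝ (Fin d)))
    (Deval D : Measure (EuclideanSpace ℝ (Fin d) × ℝ)) (m : ℕ) (η : ℝ) (B T : ℕ) : ℝ :=
  ∫ q, expectedLoss Deval (network σ q.2 q.1) ∂(trainedLaw σ 𝓤 D m η B T)

/-- `η` is an optimally tuned learning rate: it minimizes the expected validation loss over all
positive learning rates. -/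
def IsOptimalLearningRate {d : ℕ} (σ : ℝ → ℝ) (𝓤 : Measure (EuclideanSpace ℝ (Fin d)))
    (Dval D : Measure (EuclideanSpace ℝ (Fin d) × ℝ)) (m B T : ℕ) (η : ℝ) : Prop :=
  0 < η ∧ ∀ η' : ℝ, 0 < η' →
    expectedTrainedLoss σ 𝓤 Dval D m η B T ≤ expectedTrainedLoss σ 𝓤 Dval D m η' B T

/-! ### The infinite-width kernel and well-behaved distributions -/

/-- The infinite-width kernel `K(x, x') = 𝔼_{u ∼ 𝓤}[σ(⟨u, x⟩) σ(⟨u, x'⟩)]`. -/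
def limitKernel {d : ℕ} (σ : ℝ → ℝ) (𝓤 : Measure (EuclideanSpace ℝ (Fin d)))
    (x x' : EuclideanSpace ℝ (Fin d)) : ℝ :=
  ∫ u, σ (inner ℝ u x) * σ (inner ℝ u x') ∂𝓤

/-- `r` is an eigenvalue of the integral operator with kernel `K` on `L²(μ)`. -/
def IsKernelEigenvalue {d : ℕ}
    (K : EuclideanSpace ℝ (Fin d) → EuclideanSpace ℝ (Fin d) → ℝ)
    (μ : Measure (EuclideanSpace ℝ (Fin d))) (r : ℝ) : Prop :=
  ∃ f : EuclideanSpace ℝ (Fin d) → ℝ, MemLp f 2 μ ∧ ¬ (f =ᵐ[μ] 0) ∧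
    (fun x => ∫ x', K x x' * f x' ∂μ) =ᵐ[μ] fun x => r * f x

/-- The data distribution `D` on `X × ℝ`, without label noise and with target function `f`, is
well-behaved. -/
structure IsWellBehaved {d : ℕ} (X : Set (EuclideanSpace ℝ (Fin d))) (σ : ℝ → ℝ)
    (𝓤 : Measure (EuclideanSpace ℝ (Fin d)))
    (Dval D : Measure (EuclideanSpace ℝ (Fin d) × ℝ))
    (f : EuclideanSpace ℝ (Fin d) → ℝ) : Prop where
  /-- The continuous density of the inputs is strictly positive on `X`. -/
  full_support : ∃ p, HasContinuousDensity X D p ∧ ∀ x ∈ X, 0 < p x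
  /-- The kernel is positive definite on `L²(D_x)`. The integral operator is compact, so that
  this cannot be asked with a lower bound that is uniform over all eigenvalues when `L²(D_x)` is
  infinite-dimensional. -/
  kernel_pos : ∀ r : ℝ, IsKernelEigenvalue (limitKernel σ 𝓤) (inputMarginal D) r → 0 < r
  /-- The target is realizable at infinite width, with a bounded weight function `ν`. -/
  realizable : ∃ ν : EuclideanSpace ℝ (Fin d) → ℝ, Measurable ν ∧
    (∃ M : ℝ, ∀ u ∈ 𝓤.support, |ν u| ≤ M) ∧
    ∀ x ∈ X, f x = ∫ u, σ (inner ℝ u x) * ν u ∂𝓤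
  /-- For every batch size, `lim_{m → ∞} lim_{T → ∞}` of the expected training loss at the
  learning rate tuned for the validation loss is zero. -/
  compatible : ∀ B : ℕ, 1 ≤ B → ∃ (ηopt : ℕ → ℕ → ℝ) (ℓ : ℕ → ℝ),
    (∀ᶠ m in atTop, ∀ᶠ T in atTop, IsOptimalLearningRate σ 𝓤 Dval D m B T (ηopt m T)) ∧
    (∀ᶠ m in atTop,
      Tendsto (fun T => expectedTrainedLoss σ 𝓤 D D m (ηopt m T) B T) atTop (𝓝 (ℓ m))) ∧
    Tendsto ℓ atTop (𝓝 0)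

end RandomFeature

end

set_option linter.unusedSectionVars false

namespace RandomFeature

open ProbabilityTheory

/-! ### Empirical averages and streams of independent samples -/

section Averages

variable {Z : Type*} [MeasurableSpace Z] {D : Measure Z} [IsProbabilityMeasure D]

/-! Each of the two expected validation losses is within |Δ_AB| / 2 of the validation loss of its
target, once m and ηT are large and η is small, uniformly in B; the difference of the losses then
has the sign of Δ_AB. Since the validation density is bounded above on the compact `X` and the
training density is bounded below there, the mean square distance of the network to its target under
validation is at most a constant times its training error. Hence it suffices that the expected
training error is O(1/(ηT) + 1/m + η), which is `integral_prod_trainedError_le`.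

For frozen `U`, training is least mean squares with features of norm at most C. The comparator is w
= (ν(u_i)/√m)_i: its norm is at most M for every width, and its mean square residual S(U) has mean
O(1/m), because its network is a Monte Carlo average for the target. Gradient descent on the
expected loss reaches training error O(‖w‖²/(ηT) + S) by the standard potential argument with ‖θ_t -
w‖². No lower bound on the eigenvalues of the feature covariance enters.

It remains to control the stochastic noise, which is proportional to the residuals that training
itself produces. Let A = 1 - η H with H = 𝔼[ψψᵀ]. Noise injected k steps before the end is seen in
direction v through A^k v, and Σ_k η ⟨A^k v, H A^k v⟩ telescopes to at most ‖v‖². So the accumulated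
noise, averaged over the sample at which it is observed, is at most ηC² ∫ R, where R(z) is the
largest mean square residual at z over time (`integral_accumulatedNoise_le`). As the noise bound
increases with time, R is bounded pointwise by the maximal residual of gradient descent plus noise,
and for ηC² ≤ 1/4 the noise is absorbed (`integral_meanSqResidual_le`).

The maximal residual of gradient descent is integrable because w almost fits: the part driven by the
misfit of w is at most S times a leverage score of integral at most m (`exists_leverage`). Since S
has mean O(1/m), the product m S stays bounded on average, uniformly in the width. -/

/-- The average of `g` over `n` points. -/
noncomputable def sampleMean {Z : Type*} (n : ℕ) (g : Z → ℝ) (x : Fin n → Z) : ℝ :=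
  1 / (n : ℝ) * ∑ i, g (x i)

theorem memLp_sampleMean {n : ℕ} {g : Z → ℝ} (hg : MemLp g 2 D) :
    MemLp (sampleMean n g) 2 (Measure.pi fun _ : Fin n => D) := by
  unfold sampleMean
  have h : ∀ i ∈ (Finset.univ : Finset (Fin n)),
      MemLp (fun x : Fin n → Z => g (x i)) 2 (Measure.pi fun _ : Fin n => D) := fun i _ =>
    hg.comp_measurePreserving (measurePreserving_eval (fun _ : Fin n => D) i)
  exact (memLp_finsetSum Finset.univ h).const_mul _

theorem integral_sampleMean {n : ℕ} (hn : 1 ≤ n) {g : Z → ℝ} (hg : MemLp g 2 D) :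
    ∫ x, sampleMean n g x ∂(Measure.pi fun _ : Fin n => D) = ∫ z, g z ∂D := by
  have hn' : (n : ℝ) ≠ 0 := by positivity
  unfold sampleMean
  rw [integral_const_mul, integral_finsetSum]
  · have : ∀ i : Fin n, ∫ x : Fin n → Z, g (x i) ∂(Measure.pi fun _ : Fin n => D) = ∫ z, g z ∂D :=
      fun i => integral_comp_eval (μ := fun _ : Fin n => D) hg.aestronglyMeasurable
    simp only [this, Finset.sum_const, Finset.card_univ, Fintype.card_fin, nsmul_eq_mul]
    field_simp
  · intro i _
    exact ((hg.comp_measurePreserving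
      (measurePreserving_eval (fun _ : Fin n => D) i)).integrable one_le_two)

theorem variance_sampleMean {n : ℕ} (hn : 1 ≤ n) {g : Z → ℝ} (hg : MemLp g 2 D) :
    ∫ x, (sampleMean n g x - ∫ z, g z ∂D) ^ 2 ∂(Measure.pi fun _ : Fin n => D)
      ≤ 1 / (n : ℝ) * ∫ z, g z ^ 2 ∂D := by
  have hn' : (n : ℝ) ≠ 0 := by positivity
  have h1 := variance_eq_integral (memLp_sampleMean (n := n) hg).aestronglyMeasurable.aemeasurable
  rw [integral_sampleMean hn hg] at h1
  rw [← h1]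
  have h2 : sampleMean n g = fun x => 1 / (n : ℝ) * (∑ i, fun ω : Fin n → Z => g (ω i)) x := by
    funext x; simp [sampleMean]
  rw [h2, variance_const_mul, variance_sum_pi (X := fun _ => g) (fun _ => hg)]
  simp only [Finset.sum_const, Finset.card_univ, Fintype.card_fin, nsmul_eq_mul]
  have h3 := variance_le_expectation_sq hg.aestronglyMeasurable
  simp only [Pi.pow_apply] at h3
  calc (1 / (n : ℝ)) ^ 2 * (n * Var[g; D]) = 1 / (n : ℝ) * Var[g; D] := by field_simp
    _ ≤ _ := by gcongr

/-- The mean square of an affine function of a centred empirical average. -/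
theorem integral_sq_sub_sampleMean_le {n : ℕ} (hn : 1 ≤ n) {g : Z → ℝ} (hg : MemLp g 2 D)
    (a η : ℝ) :
    ∫ x, (a - η * (sampleMean n g x - ∫ z, g z ∂D)) ^ 2 ∂(Measure.pi fun _ : Fin n => D)
      ≤ a ^ 2 + η ^ 2 * ∫ z, g z ^ 2 ∂D := by
  have hm := memLp_sampleMean (n := n) hg
  have hc : MemLp (fun x => sampleMean n g x - ∫ z, g z ∂D) 2 (Measure.pi fun _ : Fin n => D) :=
    hm.sub (memLp_const _)
  have h0 : ∫ x, (sampleMean n g x - ∫ z, g z ∂D) ∂(Measure.pi fun _ : Fin n => D) = 0 := by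
    rw [integral_sub (hm.integrable one_le_two) (integrable_const _), integral_sampleMean hn hg]
    simp
  have h1 : ∀ x, (a - η * (sampleMean n g x - ∫ z, g z ∂D)) ^ 2
      = a ^ 2 + ((-2 * a * η) * (sampleMean n g x - ∫ z, g z ∂D)
        + η ^ 2 * (sampleMean n g x - ∫ z, g z ∂D) ^ 2) := fun x => by ring
  have i1 := (hc.integrable one_le_two).const_mul (-2 * a * η)
  have i2 := hc.integrable_sq.const_mul (η ^ 2)
  simp_rw [h1]
  have i3 : Integrable (fun x => (-2 * a * η) * (sampleMean n g x - ∫ z, g z ∂D)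
        + η ^ 2 * (sampleMean n g x - ∫ z, g z ∂D) ^ 2) (Measure.pi fun _ : Fin n => D) :=
    i1.add i2
  rw [integral_add (integrable_const _) i3, integral_add i1 i2, integral_const_mul,
    integral_const_mul, h0]
  have h2 := variance_sampleMean hn hg
  -- The gain 1/n from averaging is discarded here, which makes all later bounds uniform in the
  -- batch size.
  have h3 : 1 / (n : ℝ) * ∫ z, g z ^ 2 ∂D ≤ ∫ z, g z ^ 2 ∂D := by
    have : (1 : ℝ) ≤ n := by exact_mod_cast hn
    have h4 : 0 ≤ ∫ z, g z ^ 2 ∂D := integral_nonneg fun _ => sq_nonneg _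
    refine mul_le_of_le_one_left h4 ?_
    rw [div_le_one (by positivity)]; exact this
  simp only [integral_const, probReal_univ, smul_eq_mul, one_mul, mul_zero, zero_add]
  have := mul_le_mul_of_nonneg_left (h2.trans h3) (sq_nonneg η)
  linarith

/-- In a stream of independent samples, the state before time `t` of a recursion driven by the
stream is independent of the sample at time `t`. -/
theorem map_recursion_prod {E : Type*} [MeasurableSpace E] {F : ℕ → (ℕ → Z) → E} {s : Z → E → E}
    (hF : ∀ t, Measurable (F t)) (h0 : ∀ ω ω', F 0 ω = F 0 ω')
    (hs : ∀ t ω, F (t + 1) ω = s (ω t) (F t ω)) (t : ℕ) :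
    (Measure.infinitePi fun _ : ℕ => D).map (fun ω => (F t ω, ω t))
      = ((Measure.infinitePi fun _ : ℕ => D).map (F t)).prod D := by
  obtain ⟨z₀⟩ : Nonempty Z := nonempty_of_isProbabilityMeasure D
  have hdep : ∀ t, ∀ ω ω' : ℕ → Z, (∀ i < t, ω i = ω' i) → F t ω = F t ω' := by
    intro t
    induction t with
    | zero => intro ω ω' _; exact h0 ω ω'
    | succ k ih =>
      intro ω ω' h
      rw [hs, hs, h k (Nat.lt_succ_self k), ih ω ω' fun i hi => h i (hi.trans (Nat.lt_succ_self k))]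
  let ext : ((i : Finset.range t) → Z) → ℕ → Z :=
    fun x i => if h : i ∈ Finset.range t then x ⟨i, h⟩ else z₀
  have hext : Measurable ext := by
    refine measurable_pi_lambda _ fun i => ?_
    by_cases h : i ∈ Finset.range t
    · simp only [ext, h, dif_pos]; exact measurable_pi_apply _
    · simp only [ext, h, dif_neg, not_false_eq_true]; exact measurable_const
  -- The state at time t only sees the coordinates below t, so it factors through them; the later
  -- coordinates may be filled with the arbitrary `z₀`. Independence of disjoint blocks of
  -- coordinates then applies.
  have hFt : F t = (F t ∘ ext) ∘ fun ω (i : Finset.range t) => ω i := by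
    funext ω
    refine hdep t _ _ fun i hi => ?_
    simp [ext, hi]
  have hind : iIndepFun (fun (i : ℕ) (ω : ℕ → Z) => ω i) (Measure.infinitePi fun _ : ℕ => D) :=
    iIndepFun_infinitePi (X := fun _ (z : Z) => z) (fun _ => measurable_id)
  have h1 := hind.indepFun_finset (Finset.range t) {t} (by simp) (fun i => measurable_pi_apply i)
  have hev : Measurable fun x : (({t} : Finset ℕ) → Z) => x ⟨t, by simp⟩ :=
    measurable_pi_apply _
  have h2 := h1.comp (φ := F t ∘ ext)
    (ψ := fun x : (({t} : Finset ℕ) → Z) => x ⟨t, by simp⟩)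
    ((hF t).comp hext) hev
  rw [← hFt] at h2
  have h3 := (indepFun_iff_map_prod_eq_prod_map_map (hF t).aemeasurable
    (measurable_pi_apply t).aemeasurable).1 h2
  convert h3 using 2
  exact (Measure.infinitePi_map_eval (fun _ : ℕ => D) t).symm

end Averages

/-! ### Least mean squares with bounded features and labels -/

theorem integrable_of_measurable_of_abs_le {Z : Type*} [MeasurableSpace Z] {μ : Measure Z}
    [IsFiniteMeasure μ] {f : Z → ℝ} (hf : Measurable f) {K : ℝ} (h : ∀ z, |f z| ≤ K) :
    Integrable f μ :=
  Integrable.of_bound hf.aestronglyMeasurable K (ae_of_all _ fun z => h z)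

/-- Measurable features `ψ` and labels `y` with `‖ψ‖ ≤ C` and `|y| ≤ Y`. -/
structure IsBoundedRegression {Z E : Type*} [MeasurableSpace Z] [NormedAddCommGroup E]
    [MeasurableSpace E] (ψ : Z → E) (y : Z → ℝ) (C Y : ℝ) : Prop where
  measurable_feature : Measurable ψ
  norm_feature_le : ∀ z, ‖ψ z‖ ≤ C
  measurable_label : Measurable y
  abs_label_le : ∀ z, |y z| ≤ Y

section LMS

variable {Z E : Type*} [MeasurableSpace Z] [NormedAddCommGroup E] [InnerProductSpace ℝ E]
  [MeasurableSpace E]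

/-- The residual of the linear predictor with weights `θ`. -/
noncomputable def residual (ψ : Z → E) (y : Z → ℝ) (θ : E) (z : Z) : ℝ :=
  inner ℝ θ (ψ z) - y z

/-- One mini-batch step of least mean squares. -/
noncomputable def lmsStep (ψ : Z → E) (y : Z → ℝ) (η : ℝ) {B : ℕ} (batch : Fin B → Z) (θ : E) :
    E :=
  θ - (η / (B : ℝ)) • ∑ b, residual ψ y θ (batch b) • ψ (batch b)

/-- The iterates of least mean squares, started at zero. -/
noncomputable def lmsIterate (ψ : Z → E) (y : Z → ℝ) (η : ℝ) {B : ℕ} (ω : ℕ → Fin B → Z) : ℕ → E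
  | 0 => 0
  | t + 1 => lmsStep ψ y η (ω t) (lmsIterate ψ y η ω t)

/-- The operator `𝔼[ψ ψᵀ]`. -/
noncomputable def secondMoment (D : Measure Z) (ψ : Z → E) : E →L[ℝ] E :=
  ∫ z, InnerProductSpace.rankOne ℝ (ψ z) (ψ z) ∂D

/-- The gradient of the expected loss. -/
noncomputable def meanGradient (D : Measure Z) (ψ : Z → E) (y : Z → ℝ) (θ : E) : E :=
  ∫ z, residual ψ y θ z • ψ z ∂D

/-- The iterates of gradient descent on the expected loss, started at zero. -/
noncomputable def gdIterate (D : Measure Z) (ψ : Z → E) (y : Z → ℝ) (η : ℝ) : ℕ → E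
  | 0 => 0
  | t + 1 => gdIterate D ψ y η t - η • meanGradient D ψ y (gdIterate D ψ y η t)

/-- The linear part `1 - η 𝔼[ψ ψᵀ]` of a gradient descent step. -/
noncomputable def gdOperator (D : Measure Z) (ψ : Z → E) (η : ℝ) : E →L[ℝ] E :=
  ContinuousLinearMap.id ℝ E - η • secondMoment D ψ

/-- An upper bound for the norm of the `t`-th least mean squares iterate. -/
def iterateBound (C Y η : ℝ) : ℕ → ℝ
  | 0 => 0
  | t + 1 => iterateBound C Y η t + |η| * ((iterateBound C Y η t * C + Y) * C)

variable [FiniteDimensional ℝ E] [BorelSpace E] [CompleteSpace E]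
variable {ψ : Z → E} {y : Z → ℝ} {C Y : ℝ} {D : Measure Z} [IsProbabilityMeasure D]

namespace IsBoundedRegression

theorem measurable_residual_uncurry (h : IsBoundedRegression ψ y C Y) :
    Measurable fun p : E × Z => residual ψ y p.1 p.2 := by
  have h1 := h.measurable_feature
  have h2 := h.measurable_label
  unfold residual
  fun_prop

theorem measurable_residual (h : IsBoundedRegression ψ y C Y) (θ : E) :
    Measurable (residual ψ y θ) :=
  h.measurable_residual_uncurry.comp measurable_prodMk_left

theorem abs_residual_le (h : IsBoundedRegression ψ y C Y) {θ : E} {K : ℝ} (hθ : ‖θ‖ ≤ K) (z : Z) :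
    |residual ψ y θ z| ≤ K * C + Y := by
  have h1 := abs_real_inner_le_norm θ (ψ z)
  have h2 := h.norm_feature_le z
  have h3 : ‖θ‖ * ‖ψ z‖ ≤ K * C := mul_le_mul hθ h2 (norm_nonneg _) ((norm_nonneg _).trans hθ)
  have h4 := abs_sub (inner ℝ θ (ψ z)) (y z)
  have h5 := h.abs_label_le z
  unfold residual
  linarith

theorem measurable_inner (h : IsBoundedRegression ψ y C Y) (v : E) :
    Measurable fun z => (inner ℝ v (ψ z) : ℝ) := by
  have h1 := h.measurable_feature
  fun_prop

theorem abs_inner_le (h : IsBoundedRegression ψ y C Y) (v : E) (z : Z) :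
    |(inner ℝ v (ψ z) : ℝ)| ≤ ‖v‖ * C :=
  (abs_real_inner_le_norm v (ψ z)).trans
    (mul_le_mul_of_nonneg_left (h.norm_feature_le z) (norm_nonneg _))

theorem integrable_smul (h : IsBoundedRegression ψ y C Y) {p : Z → ℝ} (hp : Measurable p) {K : ℝ}
    (hK : ∀ z, |p z| ≤ K) : Integrable (fun z => p z • ψ z) D := by
  refine Integrable.of_bound (hp.smul h.measurable_feature).aestronglyMeasurable (K * C)
    (ae_of_all _ fun z => ?_)
  rw [norm_smul]
  exact mul_le_mul (hK z) (h.norm_feature_le z) (norm_nonneg _) ((abs_nonneg _).trans (hK z))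

theorem inner_integral_smul (h : IsBoundedRegression ψ y C Y) {p : Z → ℝ} (hp : Measurable p)
    {K : ℝ} (hK : ∀ z, |p z| ≤ K) (v : E) :
    inner ℝ v (∫ z, p z • ψ z ∂D) = ∫ z, p z * inner ℝ v (ψ z) ∂D := by
  rw [← integral_inner (h.integrable_smul hp hK)]
  simp only [inner_smul_right]

theorem integrable_rankOne (h : IsBoundedRegression ψ y C Y) :
    Integrable (fun z => (InnerProductSpace.rankOne ℝ (ψ z) (ψ z) : E →L[ℝ] E)) D := by
  have hc : Continuous fun x : E => (InnerProductSpace.rankOne ℝ x x : E →L[ℝ] E) :=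
    (InnerProductSpace.rankOne ℝ : E →L[ℝ] E →L⋆[ℝ] E →L[ℝ] E).continuous₂.comp
      (continuous_id.prodMk continuous_id)
  refine Integrable.of_bound
    (hc.comp_aestronglyMeasurable h.measurable_feature.aestronglyMeasurable) (C * C)
    (ae_of_all _ fun z => ?_)
  rw [InnerProductSpace.norm_rankOne]
  exact mul_le_mul (h.norm_feature_le z) (h.norm_feature_le z) (norm_nonneg _)
    ((norm_nonneg _).trans (h.norm_feature_le z))

theorem secondMoment_apply (h : IsBoundedRegression ψ y C Y) (v : E) :
    secondMoment D ψ v = ∫ z, (inner ℝ v (ψ z) : ℝ) • ψ z ∂D := by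
  unfold secondMoment
  rw [ContinuousLinearMap.integral_apply h.integrable_rankOne]
  simp only [InnerProductSpace.rankOne_apply, real_inner_comm]

theorem inner_secondMoment (h : IsBoundedRegression ψ y C Y) (v w : E) :
    inner ℝ w (secondMoment D ψ v) = ∫ z, inner ℝ v (ψ z) * inner ℝ w (ψ z) ∂D := by
  rw [h.secondMoment_apply, h.inner_integral_smul (h.measurable_inner v) (h.abs_inner_le v)]

theorem secondMoment_symm (h : IsBoundedRegression ψ y C Y) (v w : E) :
    inner ℝ (secondMoment D ψ w) v = inner ℝ w (secondMoment D ψ v) := by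
  rw [real_inner_comm, h.inner_secondMoment, h.inner_secondMoment]
  simp only [mul_comm]

theorem inner_secondMoment_self (h : IsBoundedRegression ψ y C Y) (v : E) :
    inner ℝ v (secondMoment D ψ v) = ∫ z, (inner ℝ v (ψ z) : ℝ) ^ 2 ∂D := by
  rw [h.inner_secondMoment]
  simp only [sq]

/-- For γ the integral, ‖γ‖² = ∫ p ⟨γ, ψ⟩, and the integrand is at most C² p² / 2 + ‖γ‖² / 2; the
last term is absorbed on the left. With p a residual this bounds a gradient by its own loss; with p
= ⟨v, ψ⟩ it gives H² ≤ C² H for H = `secondMoment D ψ`. -/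
theorem norm_sq_integral_smul_le (h : IsBoundedRegression ψ y C Y) {p : Z → ℝ} (hp : Measurable p)
    {K : ℝ} (hK : ∀ z, |p z| ≤ K) :
    ‖∫ z, p z • ψ z ∂D‖ ^ 2 ≤ C ^ 2 * ∫ z, p z ^ 2 ∂D := by
  set γ := ∫ z, p z • ψ z ∂D with hγ
  have h1 : ‖γ‖ ^ 2 = ∫ z, p z * inner ℝ γ (ψ z) ∂D := by
    rw [← h.inner_integral_smul hp hK, ← hγ, real_inner_self_eq_norm_sq]
  have hp2 : Integrable (fun z => p z ^ 2) D :=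
    integrable_of_measurable_of_abs_le (hp.pow_const 2) (K := K ^ 2) fun z => by
      rw [abs_pow]; exact pow_le_pow_left₀ (abs_nonneg _) (hK z) 2
  have h2 : ∫ z, p z * inner ℝ γ (ψ z) ∂D ≤ ∫ z, (C ^ 2 / 2 * p z ^ 2 + ‖γ‖ ^ 2 / 2) ∂D := by
    refine integral_mono ?_ ((hp2.const_mul _).add (integrable_const _)) fun z => ?_
    · refine integrable_of_measurable_of_abs_le (hp.mul (h.measurable_inner γ))
        (K := K * (‖γ‖ * C)) fun z => ?_
      rw [abs_mul]
      exact mul_le_mul (hK z) (h.abs_inner_le γ z) (abs_nonneg _) ((abs_nonneg _).trans (hK z))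
    · have h3 := h.abs_inner_le γ z
      have h4 : p z * inner ℝ γ (ψ z) ≤ |p z| * (‖γ‖ * C) :=
        (le_abs_self _).trans (by rw [abs_mul]; gcongr)
      have h5 : p z ^ 2 = |p z| ^ 2 := (sq_abs _).symm
      simp only
      rw [h5]
      nlinarith [sq_nonneg (C * |p z| - ‖γ‖)]
  rw [integral_add (hp2.const_mul _) (integrable_const _), integral_const_mul] at h2
  simp only [integral_const, probReal_univ, smul_eq_mul, one_mul] at h2
  linarith

theorem norm_sq_secondMoment_le (h : IsBoundedRegression ψ y C Y) (v : E) :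
    ‖secondMoment D ψ v‖ ^ 2 ≤ C ^ 2 * inner ℝ v (secondMoment D ψ v) := by
  rw [h.inner_secondMoment_self, h.secondMoment_apply]
  exact h.norm_sq_integral_smul_le (h.measurable_inner v) (h.abs_inner_le v)

theorem gdOperator_symm (h : IsBoundedRegression ψ y C Y) (η : ℝ) (v w : E) :
    inner ℝ (gdOperator D ψ η w) v = inner ℝ w (gdOperator D ψ η v) := by
  simp only [gdOperator, sub_apply, ContinuousLinearMap.id_apply,
    smul_apply, inner_sub_left, inner_sub_right, inner_smul_left,
    inner_smul_right, h.secondMoment_symm, RCLike.conj_to_real]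

theorem gdOperator_pow_symm (h : IsBoundedRegression ψ y C Y) (η : ℝ) (k : ℕ) (v w : E) :
    inner ℝ ((gdOperator D ψ η ^ k) w) v = inner ℝ w ((gdOperator D ψ η ^ k) v) := by
  induction k generalizing v w with
  | zero => simp
  | succ k ih =>
    rw [pow_succ, mul_apply_eq_comp, ih, h.gdOperator_symm,
      ← mul_apply_eq_comp, ← pow_succ', ← pow_succ]

/-- Each gradient descent step reduces the norm by at least the loss it leaves behind. -/
theorem norm_sq_gdOperator_le (h : IsBoundedRegression ψ y C Y) {η : ℝ} (hη : 0 ≤ η)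
    (hηC : η * C ^ 2 ≤ 1) (v : E) :
    η * inner ℝ v (secondMoment D ψ v) ≤ ‖v‖ ^ 2 - ‖gdOperator D ψ η v‖ ^ 2 := by
  have h1 : ‖gdOperator D ψ η v‖ ^ 2 = ‖v‖ ^ 2 - 2 * (η * inner ℝ v (secondMoment D ψ v))
      + η ^ 2 * ‖secondMoment D ψ v‖ ^ 2 := by
    simp only [gdOperator, sub_apply, ContinuousLinearMap.id_apply,
      smul_apply]
    rw [norm_sub_sq_real, inner_smul_right, norm_smul, mul_pow, Real.norm_eq_abs, sq_abs]
  have h2 := h.norm_sq_secondMoment_le (D := D) v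
  have h3 : 0 ≤ inner ℝ v (secondMoment D ψ v) := by
    rw [h.inner_secondMoment_self]; exact integral_nonneg fun _ => sq_nonneg _
  have h4 : η ^ 2 * ‖secondMoment D ψ v‖ ^ 2 ≤ η * inner ℝ v (secondMoment D ψ v) := by
    calc η ^ 2 * ‖secondMoment D ψ v‖ ^ 2
        ≤ η ^ 2 * (C ^ 2 * inner ℝ v (secondMoment D ψ v)) := by gcongr
      _ = (η * C ^ 2) * (η * inner ℝ v (secondMoment D ψ v)) := by ring
      _ ≤ 1 * (η * inner ℝ v (secondMoment D ψ v)) := by gcongr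
      _ = _ := one_mul _
  linarith

theorem norm_gdOperator_pow_le (h : IsBoundedRegression ψ y C Y) {η : ℝ} (hη : 0 ≤ η)
    (hηC : η * C ^ 2 ≤ 1) (k : ℕ) (v : E) : ‖(gdOperator D ψ η ^ k) v‖ ≤ ‖v‖ := by
  induction k with
  | zero => simp
  | succ k ih =>
    rw [pow_succ', mul_apply_eq_comp]
    refine le_trans ?_ ih
    have h1 := h.norm_sq_gdOperator_le (D := D) hη hηC ((gdOperator D ψ η ^ k) v)
    have h3 : 0 ≤ inner ℝ ((gdOperator D ψ η ^ k) v)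
        (secondMoment D ψ ((gdOperator D ψ η ^ k) v)) := by
      rw [h.inner_secondMoment_self]; exact integral_nonneg fun _ => sq_nonneg _
    have h4 := mul_nonneg hη h3
    exact (sq_le_sq₀ (norm_nonneg _) (norm_nonneg _)).1 (by linarith)

/-- Telescoping of `norm_sq_gdOperator_le`. The bound depends neither on n nor on the spectrum, so
noise can be summed over arbitrarily many steps. -/
theorem sum_inner_secondMoment_le (h : IsBoundedRegression ψ y C Y) {η : ℝ} (hη : 0 ≤ η)
    (hηC : η * C ^ 2 ≤ 1) (n : ℕ) (v : E) :
    η * ∑ k ∈ Finset.range n, inner ℝ ((gdOperator D ψ η ^ k) v)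
      (secondMoment D ψ ((gdOperator D ψ η ^ k) v)) ≤ ‖v‖ ^ 2 := by
  have h1 : ∀ n, η * ∑ k ∈ Finset.range n, inner ℝ ((gdOperator D ψ η ^ k) v)
      (secondMoment D ψ ((gdOperator D ψ η ^ k) v))
        ≤ ‖v‖ ^ 2 - ‖(gdOperator D ψ η ^ n) v‖ ^ 2 := by
    intro n
    induction n with
    | zero => simp
    | succ n ih =>
      rw [Finset.sum_range_succ, mul_add, pow_succ' _ n, mul_apply_eq_comp]
      have := h.norm_sq_gdOperator_le (D := D) hη hηC ((gdOperator D ψ η ^ n) v)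
      linarith
  have := h1 n
  nlinarith [sq_nonneg ‖(gdOperator D ψ η ^ n) v‖]

theorem meanGradient_sub (h : IsBoundedRegression ψ y C Y) (θ θ' : E) :
    meanGradient D ψ y θ - meanGradient D ψ y θ' = secondMoment D ψ (θ - θ') := by
  unfold meanGradient
  rw [← integral_sub (h.integrable_smul (h.measurable_residual θ) (h.abs_residual_le le_rfl))
    (h.integrable_smul (h.measurable_residual θ') (h.abs_residual_le le_rfl)),
    h.secondMoment_apply]
  refine integral_congr_ae (ae_of_all _ fun z => ?_)
  simp only [residual, inner_sub_left, ← sub_smul]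
  congr 1
  ring

/-- A crude deterministic bound that may grow with t. It only serves to make expectations finite and
does not enter any of the final estimates. -/
theorem norm_lmsIterate_le (h : IsBoundedRegression ψ y C Y) (η : ℝ) {B : ℕ}
    (hB : 1 ≤ B) (ω : ℕ → Fin B → Z) (t : ℕ) : ‖lmsIterate ψ y η ω t‖ ≤ iterateBound C Y η t := by
  induction t with
  | zero => simp [lmsIterate, iterateBound]
  | succ t ih =>
    simp only [lmsIterate, lmsStep, iterateBound]
    set θ := lmsIterate ψ y η ω t
    set K := iterateBound C Y η t
    refine (norm_sub_le _ _).trans (add_le_add ih ?_)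
    rw [norm_smul, norm_div, Real.norm_eq_abs, RCLike.norm_natCast, div_mul_eq_mul_div,
      div_le_iff₀ (by positivity), mul_assoc]
    refine mul_le_mul_of_nonneg_left ?_ (abs_nonneg _)
    refine (norm_sum_le _ _).trans ?_
    have : ∀ b ∈ (Finset.univ : Finset (Fin B)), ‖residual ψ y θ (ω t b) • ψ (ω t b)‖
        ≤ (K * C + Y) * C := fun b _ => by
      rw [norm_smul]
      exact mul_le_mul (h.abs_residual_le ih _) (h.norm_feature_le _) (norm_nonneg _)
        ((abs_nonneg _).trans (h.abs_residual_le ih (ω t b)))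
    refine (Finset.sum_le_sum this).trans ?_
    simp [mul_comm]

theorem measurable_lmsStep (h : IsBoundedRegression ψ y C Y) (η : ℝ) (B : ℕ) :
    Measurable fun p : (Fin B → Z) × E => lmsStep ψ y η p.1 p.2 := by
  unfold lmsStep
  refine measurable_snd.sub (Measurable.const_smul (Finset.measurable_sum _ fun b _ => ?_) _)
  have h1 : Measurable fun p : (Fin B → Z) × E => p.1 b := by fun_prop
  exact (h.measurable_residual_uncurry.comp (measurable_snd.prodMk h1)).smul
    (h.measurable_feature.comp h1)

theorem measurable_lmsIterate (h : IsBoundedRegression ψ y C Y) (η : ℝ) (B : ℕ) (t : ℕ) :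
    Measurable fun ω : ℕ → Fin B → Z => lmsIterate ψ y η ω t := by
  induction t with
  | zero => exact measurable_const
  | succ t ih => exact (h.measurable_lmsStep η B).comp ((measurable_pi_apply t).prodMk ih)

end IsBoundedRegression

end LMS

/-! ### Propagation of the gradient noise -/

section SecondMoments

variable {Z E : Type*} [MeasurableSpace Z] [NormedAddCommGroup E] [InnerProductSpace ℝ E]
  [MeasurableSpace E]

/-- The law of an infinite stream of independent batches. -/
noncomputable def streamLaw (D : Measure Z) (B : ℕ) : Measure (ℕ → Fin B → Z) :=
  Measure.infinitePi fun _ : ℕ => Measure.pi fun _ : Fin B => D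

instance {D : Measure Z} [IsProbabilityMeasure D] {B : ℕ} : IsProbabilityMeasure (streamLaw D B) :=
  inferInstanceAs (IsProbabilityMeasure (Measure.infinitePi _))

/-- The mean square residual of the `t`-th least mean squares iterate at a sample `z`. -/
noncomputable def meanSqResidual (D : Measure Z) (ψ : Z → E) (y : Z → ℝ) (η : ℝ) (B t : ℕ)
    (z : Z) : ℝ :=
  ∫ ω, residual ψ y (lmsIterate ψ y η ω t) z ^ 2 ∂(streamLaw D B)

/-- The mean square deviation of least mean squares from gradient descent in a direction `v`. -/
noncomputable def meanSqDeviation (D : Measure Z) (ψ : Z → E) (y : Z → ℝ) (η : ℝ) (B t : ℕ)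
    (v : E) : ℝ :=
  ∫ ω, inner ℝ v (lmsIterate ψ y η ω t - gdIterate D ψ y η t) ^ 2 ∂(streamLaw D B)

/-- The largest mean square residual up to time `n`. -/
noncomputable def maxMeanSqResidual (D : Measure Z) (ψ : Z → E) (y : Z → ℝ) (η : ℝ) (B n : ℕ)
    (z : Z) : ℝ :=
  (Finset.range (n + 1)).sup' Finset.nonempty_range_add_one fun t =>
    meanSqResidual D ψ y η B t z

/-- The noise that the first `n` steps of least mean squares accumulate at `z`, for residuals of
mean square `M`. -/
noncomputable def accumulatedNoise (D : Measure Z) (ψ : Z → E) (η : ℝ) (M : Z → ℝ) (n : ℕ)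
    (v : E) : ℝ :=
  η ^ 2 * ∑ k ∈ Finset.range n, ∫ z, M z * inner ℝ ((gdOperator D ψ η ^ k) v) (ψ z) ^ 2 ∂D

variable [FiniteDimensional ℝ E] [BorelSpace E] [CompleteSpace E]
variable {ψ : Z → E} {y : Z → ℝ} {C Y : ℝ} {D : Measure Z} [IsProbabilityMeasure D]

namespace IsBoundedRegression

theorem measurable_residual_lmsIterate (h : IsBoundedRegression ψ y C Y) (η : ℝ) (B t : ℕ) :
    Measurable fun p : Z × (ℕ → Fin B → Z) => residual ψ y (lmsIterate ψ y η p.2 t) p.1 :=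
  h.measurable_residual_uncurry.comp
    (((h.measurable_lmsIterate η B t).comp measurable_snd).prodMk measurable_fst)

theorem sq_residual_le (h : IsBoundedRegression ψ y C Y) {θ : E} {K : ℝ} (hθ : ‖θ‖ ≤ K) (z : Z) :
    residual ψ y θ z ^ 2 ≤ (K * C + Y) ^ 2 := by
  rw [← sq_abs]
  exact pow_le_pow_left₀ (abs_nonneg _) (h.abs_residual_le hθ z) 2

theorem integrable_sq_residual_lmsIterate (h : IsBoundedRegression ψ y C Y) (η : ℝ) {B : ℕ}
    (hB : 1 ≤ B) (t : ℕ) (z : Z) :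
    Integrable (fun ω => residual ψ y (lmsIterate ψ y η ω t) z ^ 2) (streamLaw D B) := by
  refine integrable_of_measurable_of_abs_le
    (((h.measurable_residual_lmsIterate η B t).comp measurable_prodMk_left).pow_const 2)
    (K := (iterateBound C Y η t * C + Y) ^ 2) fun ω => ?_
  rw [abs_of_nonneg (sq_nonneg _)]
  exact h.sq_residual_le (h.norm_lmsIterate_le η hB ω t) z

theorem measurable_meanSqResidual (h : IsBoundedRegression ψ y C Y) (η : ℝ) (B t : ℕ) :
    Measurable (meanSqResidual D ψ y η B t) := by
  unfold meanSqResidual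
  exact (((h.measurable_residual_lmsIterate η B t).pow_const 2).stronglyMeasurable.integral_prod_right'
    (ν := streamLaw D B)).measurable

theorem meanSqResidual_nonneg (η : ℝ) (B t : ℕ) (z : Z) : 0 ≤ meanSqResidual D ψ y η B t z :=
  integral_nonneg fun _ => sq_nonneg _

theorem meanSqResidual_le (h : IsBoundedRegression ψ y C Y) (η : ℝ) {B : ℕ} (hB : 1 ≤ B) (t : ℕ)
    (z : Z) : meanSqResidual D ψ y η B t z ≤ (iterateBound C Y η t * C + Y) ^ 2 := by
  have := integral_mono (μ := streamLaw D B) (h.integrable_sq_residual_lmsIterate η hB t z)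
    (integrable_const _) fun ω => h.sq_residual_le (h.norm_lmsIterate_le η hB ω t) z
  simpa [meanSqResidual] using this

theorem integral_sq_residual_eq (h : IsBoundedRegression ψ y C Y) (η : ℝ) {B : ℕ} (hB : 1 ≤ B)
    (t : ℕ) {g : Z → ℝ} (hg : Measurable g) {K : ℝ} (hK : ∀ z, |g z| ≤ K) :
    ∫ ω, ∫ z, residual ψ y (lmsIterate ψ y η ω t) z ^ 2 * g z ∂D ∂(streamLaw D B)
      = ∫ z, meanSqResidual D ψ y η B t z * g z ∂D := by
  rw [integral_integral_swap]
  · simp only [meanSqResidual, integral_mul_const]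
  · refine integrable_of_measurable_of_abs_le (K := (iterateBound C Y η t * C + Y) ^ 2 * K)
      ?_ fun p => ?_
    · exact (((h.measurable_residual_lmsIterate η B t).comp measurable_swap).pow_const 2).mul
        (hg.comp measurable_snd)
    · simp only [Function.uncurry]
      rw [abs_mul, abs_of_nonneg (sq_nonneg _)]
      exact mul_le_mul (h.sq_residual_le (h.norm_lmsIterate_le η hB _ t) _) (hK _)
        (abs_nonneg _) (sq_nonneg _)

/-- The mean over one batch of the squared deviation after a least mean squares step. -/
theorem integral_sq_inner_lmsStep_le (h : IsBoundedRegression ψ y C Y) (η : ℝ) {B : ℕ}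
    (hB : 1 ≤ B) (θ θ' v : E) :
    ∫ batch, inner ℝ v (lmsStep ψ y η batch θ - (θ' - η • meanGradient D ψ y θ')) ^ 2
        ∂(Measure.pi fun _ : Fin B => D)
      ≤ inner ℝ (gdOperator D ψ η v) (θ - θ') ^ 2
        + η ^ 2 * ∫ z, residual ψ y θ z ^ 2 * inner ℝ v (ψ z) ^ 2 ∂D := by
  set g : Z → ℝ := fun z => residual ψ y θ z * inner ℝ v (ψ z) with hg
  have hgm : Measurable g := (h.measurable_residual θ).mul (h.measurable_inner v)
  have hg2 : MemLp g 2 D := by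
    refine MemLp.of_bound hgm.aestronglyMeasurable ((‖θ‖ * C + Y) * (‖v‖ * C))
      (ae_of_all _ fun z => ?_)
    rw [Real.norm_eq_abs, hg, abs_mul]
    exact mul_le_mul (h.abs_residual_le le_rfl z) (h.abs_inner_le v z) (abs_nonneg _)
      ((abs_nonneg _).trans (h.abs_residual_le le_rfl z))
  have hgrad : inner ℝ v (meanGradient D ψ y θ) = ∫ z, g z ∂D :=
    h.inner_integral_smul (h.measurable_residual θ) (h.abs_residual_le le_rfl) v
  have h1 := integral_sq_sub_sampleMean_le hB hg2 (inner ℝ (gdOperator D ψ η v) (θ - θ')) η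
  -- By symmetry of the gradient descent operator, the new deviation along v is the old one along
  -- the transformed direction, minus η times a centred batch average. The cross term therefore has
  -- mean zero.
  have h2 : ∀ batch : Fin B → Z,
      inner ℝ v (lmsStep ψ y η batch θ - (θ' - η • meanGradient D ψ y θ'))
        = inner ℝ (gdOperator D ψ η v) (θ - θ') - η * (sampleMean B g batch - ∫ z, g z ∂D) := by
    intro batch
    rw [← hgrad, h.gdOperator_symm, lmsStep, gdOperator]
    simp only [sub_apply, smul_apply, ContinuousLinearMap.id_apply]
    rw [← h.meanGradient_sub]
    simp only [inner_sub_right, inner_smul_right, inner_sum, sampleMean, hg]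
    ring
  simp_rw [h2]
  refine h1.trans_eq ?_
  simp only [hg, mul_pow]

/-- The batch at time t is independent of the iterate it acts on (`map_recursion_prod`), so the
iterate can be frozen while a fresh batch is averaged out. -/
theorem integral_lmsIterate_succ (h : IsBoundedRegression ψ y C Y) (η : ℝ) {B : ℕ} (t : ℕ)
    {G : (Fin B → Z) → E → ℝ} (hG : Measurable fun p : E × (Fin B → Z) => G p.2 p.1) {K : ℝ}
    (hK : ∀ ω : ℕ → Fin B → Z, ∀ b, |G b (lmsIterate ψ y η ω t)| ≤ K) :
    ∫ ω, G (ω t) (lmsIterate ψ y η ω t) ∂(streamLaw D B)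
      = ∫ ω, ∫ b, G b (lmsIterate ψ y η ω t) ∂(Measure.pi fun _ : Fin B => D)
          ∂(streamLaw D B) := by
  have hm := h.measurable_lmsIterate η B
  have hmap := map_recursion_prod (D := Measure.pi fun _ : Fin B => D)
    (F := fun t ω => lmsIterate ψ y η ω t) (s := fun b θ => lmsStep ψ y η b θ) hm
    (fun _ _ => rfl) (fun _ _ => rfl) t
  have hpair : Measurable fun ω : ℕ → Fin B → Z => (lmsIterate ψ y η ω t, ω t) :=
    (hm t).prodMk (measurable_pi_apply t)
  have h1 : ∫ p, G p.2 p.1 ∂((streamLaw D B).map fun ω => (lmsIterate ψ y η ω t, ω t))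
      = ∫ ω, G (ω t) (lmsIterate ψ y η ω t) ∂(streamLaw D B) :=
    integral_map hpair.aemeasurable hG.aestronglyMeasurable
  have hint : Integrable (fun p : E × (Fin B → Z) => G p.2 p.1)
      ((streamLaw D B).map fun ω => (lmsIterate ψ y η ω t, ω t)) :=
    (integrable_map_measure hG.aestronglyMeasurable hpair.aemeasurable).2
      (integrable_of_measurable_of_abs_le (hG.comp hpair) fun ω => hK ω (ω t))
  unfold streamLaw at h1 hint ⊢
  rw [hmap] at h1 hint
  rw [← h1, integral_prod _ hint, integral_map (hm t).aemeasurable]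
  exact hG.stronglyMeasurable.integral_prod_right'.aestronglyMeasurable

/-- One step of the noise recursion. Working direction by direction moves the contraction onto v and
leaves the noise as an explicit weighted integral of the current mean square residual. -/
theorem meanSqDeviation_succ_le (h : IsBoundedRegression ψ y C Y) (η : ℝ) {B : ℕ} (hB : 1 ≤ B)
    (t : ℕ) (v : E) :
    meanSqDeviation D ψ y η B (t + 1) v ≤ meanSqDeviation D ψ y η B t (gdOperator D ψ η v)
      + η ^ 2 * ∫ z, meanSqResidual D ψ y η B t z * inner ℝ v (ψ z) ^ 2 ∂D := by
  have hm := h.measurable_lmsIterate η B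
  set θ' := gdIterate D ψ y η t with hθ'
  set K := iterateBound C Y η (t + 1) with hK
  set G : (Fin B → Z) → E → ℝ := fun b θ =>
    inner ℝ v (lmsStep ψ y η b θ - (θ' - η • meanGradient D ψ y θ')) ^ 2 with hGdef
  have hG : Measurable fun p : E × (Fin B → Z) => G p.2 p.1 := by
    have h1 := (h.measurable_lmsStep η B).comp (measurable_swap (α := E) (β := Fin B → Z))
    have h2 : Measurable fun p : E × (Fin B → Z) => lmsStep ψ y η p.2 p.1 := h1
    simp only [hGdef]
    fun_prop
  have hbd : ∀ ω : ℕ → Fin B → Z, ∀ b, |G b (lmsIterate ψ y η ω t)|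
      ≤ (‖v‖ * (K + ‖θ' - η • meanGradient D ψ y θ'‖)) ^ 2 := by
    intro ω b
    -- The bound is needed for a batch `b` unrelated to `ω`. Putting `b` at time t of the stream
    -- turns the step into a genuine iterate at time t + 1, to which `norm_lmsIterate_le` applies.
    let ω' : ℕ → Fin B → Z := Function.update ω t b
    have hstep : ∀ s ≤ t, lmsIterate ψ y η ω' s = lmsIterate ψ y η ω s := by
      intro s
      induction s with
      | zero => intro _; rfl
      | succ s ih =>
        intro hs
        simp only [lmsIterate]
        rw [ih (by omega)]
        simp [ω', Function.update_of_ne (show s ≠ t by omega)]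
    have h1 : lmsStep ψ y η b (lmsIterate ψ y η ω t) = lmsIterate ψ y η ω' (t + 1) := by
      simp only [lmsIterate]
      rw [hstep t le_rfl]
      simp [ω']
    simp only [hGdef]
    rw [h1, abs_pow]
    refine pow_le_pow_left₀ (abs_nonneg _) ((abs_real_inner_le_norm _ _).trans ?_) 2
    gcongr
    exact (norm_sub_le _ _).trans (add_le_add (h.norm_lmsIterate_le η hB ω' (t + 1)) le_rfl)
  have h1 : meanSqDeviation D ψ y η B (t + 1) v
      = ∫ ω, G (ω t) (lmsIterate ψ y η ω t) ∂(streamLaw D B) := rfl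
  have i1 : Integrable (fun ω => inner ℝ (gdOperator D ψ η v) (lmsIterate ψ y η ω t - θ') ^ 2)
      (streamLaw D B) := by
    have := hm t
    refine integrable_of_measurable_of_abs_le (by fun_prop)
      (K := (‖gdOperator D ψ η v‖ * (iterateBound C Y η t + ‖θ'‖)) ^ 2) fun ω => ?_
    rw [abs_pow]
    refine pow_le_pow_left₀ (abs_nonneg _) ((abs_real_inner_le_norm _ _).trans ?_) 2
    gcongr
    exact (norm_sub_le _ _).trans (add_le_add (h.norm_lmsIterate_le η hB ω t) le_rfl)
  have hv2 : ∀ z, |(inner ℝ v (ψ z) : ℝ) ^ 2| ≤ (‖v‖ * C) ^ 2 := fun z => by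
    rw [abs_pow]; exact pow_le_pow_left₀ (abs_nonneg _) (h.abs_inner_le v z) 2
  have i2 : Integrable (fun ω => η ^ 2 * ∫ z, residual ψ y (lmsIterate ψ y η ω t) z ^ 2
      * inner ℝ v (ψ z) ^ 2 ∂D) (streamLaw D B) := by
    refine Integrable.const_mul ?_ _
    refine integrable_of_measurable_of_abs_le
      (K := (iterateBound C Y η t * C + Y) ^ 2 * (‖v‖ * C) ^ 2) ?_ fun ω => ?_
    · exact (((((h.measurable_residual_lmsIterate η B t).comp measurable_swap).pow_const 2).mul
        (((h.measurable_inner v).pow_const 2).comp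
          measurable_snd)).stronglyMeasurable.integral_prod_right' (ν := D)).measurable
    · have := norm_integral_le_of_norm_le_const (μ := D)
        (f := fun z => residual ψ y (lmsIterate ψ y η ω t) z ^ 2 * inner ℝ v (ψ z) ^ 2)
        (C := (iterateBound C Y η t * C + Y) ^ 2 * (‖v‖ * C) ^ 2) (ae_of_all _ fun z => by
          rw [Real.norm_eq_abs, abs_mul, abs_of_nonneg (sq_nonneg (residual _ _ _ _))]
          exact mul_le_mul (h.sq_residual_le (h.norm_lmsIterate_le η hB _ t) _) (hv2 z)
            (abs_nonneg _) (sq_nonneg _))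
      simpa using this
  rw [h1, h.integral_lmsIterate_succ η t hG hbd,
    ← h.integral_sq_residual_eq η hB t ((h.measurable_inner v).pow_const 2) hv2,
    ← integral_const_mul, meanSqDeviation, ← integral_add i1 i2]
  refine integral_mono_of_nonneg (ae_of_all _ fun ω => integral_nonneg fun b => sq_nonneg _)
    (i1.add i2) (ae_of_all _ fun ω => ?_)
  exact h.integral_sq_inner_lmsStep_le η hB (lmsIterate ψ y η ω t) θ' v

theorem measurable_maxMeanSqResidual (h : IsBoundedRegression ψ y C Y) (η : ℝ) (B n : ℕ) :
    Measurable (maxMeanSqResidual D ψ y η B n) :=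
  Finset.measurable_range_sup'' fun t _ => h.measurable_meanSqResidual η B t

theorem meanSqResidual_le_max (η : ℝ) (B : ℕ) {t n : ℕ} (ht : t ≤ n) (z : Z) :
    meanSqResidual D ψ y η B t z ≤ maxMeanSqResidual D ψ y η B n z :=
  Finset.le_sup' (fun t => meanSqResidual D ψ y η B t z) (Finset.mem_range.2 (by omega))

theorem maxMeanSqResidual_nonneg (η : ℝ) (B n : ℕ) (z : Z) :
    0 ≤ maxMeanSqResidual D ψ y η B n z :=
  (meanSqResidual_nonneg η B 0 z).trans (meanSqResidual_le_max η B (Nat.zero_le n) z)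

theorem exists_maxMeanSqResidual_le (h : IsBoundedRegression ψ y C Y) (η : ℝ) {B : ℕ}
    (hB : 1 ≤ B) (n : ℕ) : ∃ K, ∀ z, maxMeanSqResidual D ψ y η B n z ≤ K := by
  refine ⟨(Finset.range (n + 1)).sup' Finset.nonempty_range_add_one fun t =>
    (iterateBound C Y η t * C + Y) ^ 2, fun z => ?_⟩
  exact Finset.sup'_mono_fun fun t _ => h.meanSqResidual_le η hB t z

theorem integrable_maxMeanSqResidual (h : IsBoundedRegression ψ y C Y) (η : ℝ) {B : ℕ}
    (hB : 1 ≤ B) (n : ℕ) : Integrable (maxMeanSqResidual D ψ y η B n) D := by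
  obtain ⟨K, hK⟩ := h.exists_maxMeanSqResidual_le (D := D) η hB n
  exact integrable_of_measurable_of_abs_le (h.measurable_maxMeanSqResidual η B n) fun z => by
    rw [abs_of_nonneg (maxMeanSqResidual_nonneg η B n z)]; exact hK z

theorem integrable_mul_sq_inner (h : IsBoundedRegression ψ y C Y) {M : Z → ℝ}
    (hM : Integrable M D) (v : E) : Integrable (fun z => M z * inner ℝ v (ψ z) ^ 2) D := by
  refine hM.mul_bdd (c := (‖v‖ * C) ^ 2) ((h.measurable_inner v).pow_const 2).aestronglyMeasurable
    (ae_of_all _ fun z => ?_)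
  rw [Real.norm_eq_abs, abs_pow]
  exact pow_le_pow_left₀ (abs_nonneg _) (h.abs_inner_le v z) 2

/-- The recursion is unrolled backwards in time: the index k counts the steps from the injection of
the noise to time t. Replacing every residual by its maximum over time frees the noise weight from
k. -/
theorem meanSqDeviation_le_accumulatedNoise (h : IsBoundedRegression ψ y C Y) (η : ℝ) {B : ℕ}
    (hB : 1 ≤ B) {t n : ℕ} (ht : t ≤ n) (v : E) :
    meanSqDeviation D ψ y η B t v
      ≤ accumulatedNoise D ψ η (maxMeanSqResidual D ψ y η B n) t v := by
  induction t generalizing v with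
  | zero => simp [meanSqDeviation, accumulatedNoise, lmsIterate, gdIterate]
  | succ t ih =>
    have h1 := h.meanSqDeviation_succ_le (D := D) η hB t v
    have h2 := ih (by omega) (gdOperator D ψ η v)
    have h3 : ∫ z, meanSqResidual D ψ y η B t z * inner ℝ v (ψ z) ^ 2 ∂D
        ≤ ∫ z, maxMeanSqResidual D ψ y η B n z * inner ℝ v (ψ z) ^ 2 ∂D := by
      refine integral_mono_of_nonneg (ae_of_all _ fun z =>
        mul_nonneg (meanSqResidual_nonneg η B t z) (sq_nonneg _))
        (h.integrable_mul_sq_inner (h.integrable_maxMeanSqResidual η hB n) v)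
        (ae_of_all _ fun z => mul_le_mul_of_nonneg_right
          (meanSqResidual_le_max η B (by omega) z) (sq_nonneg _))
    have h4 := mul_le_mul_of_nonneg_left h3 (sq_nonneg η)
    have h5 : accumulatedNoise D ψ η (maxMeanSqResidual D ψ y η B n) (t + 1) v
        = accumulatedNoise D ψ η (maxMeanSqResidual D ψ y η B n) t (gdOperator D ψ η v)
          + η ^ 2 * ∫ z, maxMeanSqResidual D ψ y η B n z * inner ℝ v (ψ z) ^ 2 ∂D := by
      unfold accumulatedNoise
      rw [Finset.sum_range_succ', mul_add]
      simp only [pow_succ _ (_ : ℕ), mul_apply_eq_comp, pow_zero, one_apply_eq_self]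
    rw [h5]
    linarith

/-- This makes the noise bound at the final time valid at all earlier times simultaneously, so the
pointwise maximum over time costs nothing. -/
theorem accumulatedNoise_mono {η : ℝ} {M : Z → ℝ} (hM : ∀ z, 0 ≤ M z) {t n : ℕ} (ht : t ≤ n)
    (v : E) : accumulatedNoise D ψ η M t v ≤ accumulatedNoise D ψ η M n v := by
  unfold accumulatedNoise
  refine mul_le_mul_of_nonneg_left ?_ (sq_nonneg η)
  exact Finset.sum_le_sum_of_subset_of_nonneg (Finset.range_mono ht) fun k _ _ =>
    integral_nonneg fun z => mul_nonneg (hM z) (sq_nonneg _)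

theorem integrable_kernel_sq (h : IsBoundedRegression ψ y C Y) {η : ℝ} (hη : 0 ≤ η)
    (hηC : η * C ^ 2 ≤ 1) {M : Z → ℝ} (hM : Measurable M) {K : ℝ} (hK : ∀ z, |M z| ≤ K) (k : ℕ) :
    Integrable (fun p : Z × Z => M p.2 * inner ℝ ((gdOperator D ψ η ^ k) (ψ p.1)) (ψ p.2) ^ 2)
      (D.prod D) := by
  have hψ := h.measurable_feature
  refine integrable_of_measurable_of_abs_le (by fun_prop) (K := K * (C * C) ^ 2) fun p => ?_
  rw [abs_mul, abs_pow]
  have h1 : |(inner ℝ ((gdOperator D ψ η ^ k) (ψ p.1)) (ψ p.2) : ℝ)| ≤ C * C :=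
    (abs_real_inner_le_norm _ _).trans
      (mul_le_mul ((h.norm_gdOperator_pow_le hη hηC k _).trans (h.norm_feature_le _))
        (h.norm_feature_le _) (norm_nonneg _) ((norm_nonneg _).trans (h.norm_feature_le p.1)))
  exact mul_le_mul (hK _) (pow_le_pow_left₀ (abs_nonneg _) h1 2) (sq_nonneg _)
    ((abs_nonneg _).trans (hK p.2))

theorem integrable_accumulatedNoise (h : IsBoundedRegression ψ y C Y) {η : ℝ} (hη : 0 ≤ η)
    (hηC : η * C ^ 2 ≤ 1) {M : Z → ℝ} (hM : Measurable M) {K : ℝ} (hK : ∀ z, |M z| ≤ K) (n : ℕ) :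
    Integrable (fun z => accumulatedNoise D ψ η M n (ψ z)) D := by
  unfold accumulatedNoise
  exact (integrable_finsetSum _ fun k _ =>
    (h.integrable_kernel_sq hη hηC hM hK k).integral_prod_left).const_mul _

/-- By symmetry of the powers A^k of the gradient descent operator, the roles of the observed sample
z and the noisy sample z' can be exchanged. Integrating over z first gives ⟨A^k ψ(z'), H A^k ψ(z')⟩,
and the sum over k telescopes to at most ‖ψ(z')‖² / η, using up one of the two factors η. -/
theorem integral_accumulatedNoise_le (h : IsBoundedRegression ψ y C Y) {η : ℝ} (hη : 0 ≤ η)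
    (hηC : η * C ^ 2 ≤ 1) {M : Z → ℝ} (hM : Measurable M) (hM0 : ∀ z, 0 ≤ M z) {K : ℝ}
    (hK : ∀ z, M z ≤ K) (n : ℕ) :
    ∫ z, accumulatedNoise D ψ η M n (ψ z) ∂D ≤ η * C ^ 2 * ∫ z, M z ∂D := by
  have hK' : ∀ z, |M z| ≤ K := fun z => by rw [abs_of_nonneg (hM0 z)]; exact hK z
  have hMi : Integrable M D := integrable_of_measurable_of_abs_le hM hK'
  have hk := h.integrable_kernel_sq (D := D) hη hηC hM hK'
  unfold accumulatedNoise
  rw [integral_const_mul, integral_finsetSum _ fun k _ => (hk k).integral_prod_left]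
  have h1 : ∀ k, ∫ z, ∫ z', M z' * inner ℝ ((gdOperator D ψ η ^ k) (ψ z)) (ψ z') ^ 2 ∂D ∂D
      = ∫ z', M z' * inner ℝ ((gdOperator D ψ η ^ k) (ψ z'))
          (secondMoment D ψ ((gdOperator D ψ η ^ k) (ψ z'))) ∂D := by
    intro k
    rw [integral_integral_swap (hk k)]
    refine integral_congr_ae (ae_of_all _ fun z' => ?_)
    simp only
    rw [integral_const_mul, h.inner_secondMoment_self]
    congr 2
    funext z
    rw [h.gdOperator_pow_symm, real_inner_comm]
  simp_rw [h1]
  have h2 : ∀ k, Integrable (fun z' => M z' * inner ℝ ((gdOperator D ψ η ^ k) (ψ z'))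
          (secondMoment D ψ ((gdOperator D ψ η ^ k) (ψ z')))) D := by
    intro k
    have hψ := h.measurable_feature
    refine hMi.mul_bdd (c := C * (‖secondMoment D ψ‖ * C)) (by fun_prop)
      (ae_of_all _ fun z => ?_)
    have h3 := (h.norm_gdOperator_pow_le (D := D) hη hηC k (ψ z)).trans (h.norm_feature_le z)
    refine (abs_real_inner_le_norm _ _).trans
      (mul_le_mul h3 ?_ (norm_nonneg _) ((norm_nonneg _).trans h3))
    exact (ContinuousLinearMap.le_opNorm _ _).trans
      (mul_le_mul_of_nonneg_left h3 (norm_nonneg _))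
  rw [← integral_finsetSum _ fun k _ => h2 k, ← integral_const_mul, ← integral_const_mul]
  refine integral_mono ((integrable_finsetSum _ fun k _ => h2 k).const_mul _)
    (hMi.const_mul _) fun z => ?_
  simp only
  rw [← Finset.mul_sum]
  have h4 := h.sum_inner_secondMoment_le (D := D) hη hηC n (ψ z)
  have h5 : ‖ψ z‖ ^ 2 ≤ C ^ 2 := pow_le_pow_left₀ (norm_nonneg _) (h.norm_feature_le z) 2
  calc _ = η * M z * (η * ∑ k ∈ Finset.range n, inner ℝ ((gdOperator D ψ η ^ k) (ψ z))
          (secondMoment D ψ ((gdOperator D ψ η ^ k) (ψ z)))) := by ring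
    _ ≤ η * M z * C ^ 2 :=
        mul_le_mul_of_nonneg_left (h4.trans h5) (mul_nonneg hη (hM0 z))
    _ = _ := by ring

theorem meanSqResidual_le_gd_add_deviation (h : IsBoundedRegression ψ y C Y) (η : ℝ) {B : ℕ}
    (hB : 1 ≤ B) (t : ℕ) (z : Z) :
    meanSqResidual D ψ y η B t z ≤ 2 * residual ψ y (gdIterate D ψ y η t) z ^ 2
      + 2 * meanSqDeviation D ψ y η B t (ψ z) := by
  have i1 : Integrable (fun ω => inner ℝ (ψ z)
      (lmsIterate ψ y η ω t - gdIterate D ψ y η t) ^ 2) (streamLaw D B) := by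
    have := h.measurable_lmsIterate η B t
    refine integrable_of_measurable_of_abs_le (by fun_prop)
      (K := (‖ψ z‖ * (iterateBound C Y η t + ‖gdIterate D ψ y η t‖)) ^ 2) fun ω => ?_
    rw [abs_pow]
    refine pow_le_pow_left₀ (abs_nonneg _) ((abs_real_inner_le_norm _ _).trans ?_) 2
    gcongr
    exact (norm_sub_le _ _).trans (add_le_add (h.norm_lmsIterate_le η hB ω t) le_rfl)
  have h1 := integral_mono (μ := streamLaw D B) (h.integrable_sq_residual_lmsIterate η hB t z)
    ((integrable_const (2 * residual ψ y (gdIterate D ψ y η t) z ^ 2)).add (i1.const_mul 2))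
    fun ω => by
      have : residual ψ y (lmsIterate ψ y η ω t) z = residual ψ y (gdIterate D ψ y η t) z
          + inner ℝ (ψ z) (lmsIterate ψ y η ω t - gdIterate D ψ y η t) := by
        unfold residual
        rw [real_inner_comm (lmsIterate ψ y η ω t - gdIterate D ψ y η t), inner_sub_left]
        ring
      simp only [Pi.add_apply]
      rw [this]
      nlinarith [sq_nonneg (residual ψ y (gdIterate D ψ y η t) z
        - inner ℝ (ψ z) (lmsIterate ψ y η ω t - gdIterate D ψ y η t))]
  simp only [Pi.add_apply] at h1
  rw [integral_add (integrable_const _) (i1.const_mul 2)] at h1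
  simpa [meanSqResidual, meanSqDeviation, integral_const_mul] using h1

/-- The mean square residual of least mean squares is controlled by that of gradient descent and
by a maximal function of the residuals of gradient descent. -/
theorem integral_meanSqResidual_le (h : IsBoundedRegression ψ y C Y) {η : ℝ} (hη : 0 ≤ η)
    (hηC : η * C ^ 2 ≤ 1 / 4) {B : ℕ} (hB : 1 ≤ B) (n : ℕ) {β : Z → ℝ} (hβ : Integrable β D)
    (hmax : ∀ t ≤ n, ∀ z, residual ψ y (gdIterate D ψ y η t) z ^ 2 ≤ β z) :
    ∫ z, meanSqResidual D ψ y η B n z ∂D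
      ≤ 2 * ∫ z, residual ψ y (gdIterate D ψ y η n) z ^ 2 ∂D
        + 8 * (η * C ^ 2) * ∫ z, β z ∂D := by
  set M := maxMeanSqResidual D ψ y η B n with hMdef
  obtain ⟨K, hK⟩ := h.exists_maxMeanSqResidual_le (D := D) η hB n
  have hM := h.measurable_maxMeanSqResidual (D := D) η B n
  have hMi := h.integrable_maxMeanSqResidual (D := D) η hB n
  have hM0 := maxMeanSqResidual_nonneg (D := D) (ψ := ψ) (y := y) η B n
  have hK' : ∀ z, |M z| ≤ K := fun z => by rw [abs_of_nonneg (hM0 z)]; exact hK z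
  have hηC1 : η * C ^ 2 ≤ 1 := by linarith
  have hNi := h.integrable_accumulatedNoise (D := D) hη hηC1 hM hK' n
  have hN := h.integral_accumulatedNoise_le (D := D) hη hηC1 hM hM0 hK n
  have hdev : ∀ t ≤ n, ∀ z, meanSqDeviation D ψ y η B t (ψ z)
      ≤ accumulatedNoise D ψ η M n (ψ z) := fun t ht z =>
    (h.meanSqDeviation_le_accumulatedNoise η hB ht (ψ z)).trans (accumulatedNoise_mono hM0 ht _)
  have hMle : ∀ z, M z ≤ 2 * β z + 2 * accumulatedNoise D ψ η M n (ψ z) := by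
    intro z
    refine Finset.sup'_le _ _ fun t ht => ?_
    have ht' : t ≤ n := by have := Finset.mem_range.1 ht; omega
    have h1 := h.meanSqResidual_le_gd_add_deviation (D := D) η hB t z
    have h2 := hmax t ht' z
    have h3 := hdev t ht' z
    linarith
  have h1 : ∫ z, M z ∂D ≤ 2 * ∫ z, β z ∂D + 2 * ∫ z, accumulatedNoise D ψ η M n (ψ z) ∂D := by
    rw [← integral_const_mul, ← integral_const_mul,
      ← integral_add (hβ.const_mul 2) (hNi.const_mul 2)]
    exact integral_mono hMi ((hβ.const_mul 2).add (hNi.const_mul 2)) hMle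
  have hMint : 0 ≤ ∫ z, M z ∂D := integral_nonneg hM0
  -- The noise contributes at most 2ηC² ∫ M ≤ ½ ∫ M, which is moved to the left; this is legitimate
  -- because M is integrable.
  have h2 : ∫ z, M z ∂D ≤ 4 * ∫ z, β z ∂D := by
    have := mul_le_mul_of_nonneg_right hηC hMint
    linarith
  have i1 : Integrable (fun z => residual ψ y (gdIterate D ψ y η n) z ^ 2) D := by
    refine integrable_of_measurable_of_abs_le ((h.measurable_residual _).pow_const 2)
      (K := (‖gdIterate D ψ y η n‖ * C + Y) ^ 2) fun z => ?_
    rw [abs_of_nonneg (sq_nonneg _)]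
    exact h.sq_residual_le le_rfl z
  have h3 : ∫ z, meanSqResidual D ψ y η B n z ∂D
      ≤ 2 * ∫ z, residual ψ y (gdIterate D ψ y η n) z ^ 2 ∂D
        + 2 * ∫ z, accumulatedNoise D ψ η M n (ψ z) ∂D := by
    rw [← integral_const_mul, ← integral_const_mul,
      ← integral_add (i1.const_mul 2) (hNi.const_mul 2)]
    refine integral_mono_of_nonneg (ae_of_all _ fun z => meanSqResidual_nonneg η B n z)
      ((i1.const_mul 2).add (hNi.const_mul 2)) (ae_of_all _ fun z => ?_)
    have h4 := h.meanSqResidual_le_gd_add_deviation (D := D) η hB n z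
    have h5 := hdev n le_rfl z
    simp only
    linarith
  have h6 : η * C ^ 2 * ∫ z, M z ∂D ≤ η * C ^ 2 * (4 * ∫ z, β z ∂D) :=
    mul_le_mul_of_nonneg_left h2 (mul_nonneg hη (sq_nonneg C))
  linarith

end IsBoundedRegression

end SecondMoments

/-! ### Mean and maximal bounds for deterministic gradient descent -/

section GradientDescent

variable {Z E : Type*} [MeasurableSpace Z] [NormedAddCommGroup E] [InnerProductSpace ℝ E]
  [MeasurableSpace E] [FiniteDimensional ℝ E] [BorelSpace E] [CompleteSpace E]
variable {ψ : Z → E} {y : Z → ℝ} {C Y : ℝ} {D : Measure Z} [IsProbabilityMeasure D]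

namespace IsBoundedRegression

theorem integrable_sq_residual (h : IsBoundedRegression ψ y C Y) (θ : E) :
    Integrable (fun z => residual ψ y θ z ^ 2) D := by
  refine integrable_of_measurable_of_abs_le ((h.measurable_residual θ).pow_const 2)
    (K := (‖θ‖ * C + Y) ^ 2) fun z => ?_
  rw [abs_of_nonneg (sq_nonneg _)]
  exact h.sq_residual_le le_rfl z

theorem integral_sq_residual_sub (h : IsBoundedRegression ψ y C Y) (θ v : E) :
    ∫ z, residual ψ y (θ - v) z ^ 2 ∂D = ∫ z, residual ψ y θ z ^ 2 ∂D
      - 2 * inner ℝ v (meanGradient D ψ y θ) + inner ℝ v (secondMoment D ψ v) := by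
  have i1 := h.integrable_sq_residual (D := D) θ
  have i2 : Integrable (fun z => residual ψ y θ z * inner ℝ v (ψ z)) D := by
    refine integrable_of_measurable_of_abs_le
      ((h.measurable_residual θ).mul (h.measurable_inner v))
      (K := (‖θ‖ * C + Y) * (‖v‖ * C)) fun z => ?_
    rw [abs_mul]
    exact mul_le_mul (h.abs_residual_le le_rfl z) (h.abs_inner_le v z) (abs_nonneg _)
      ((abs_nonneg _).trans (h.abs_residual_le le_rfl z))
  have i3 : Integrable (fun z => (inner ℝ v (ψ z) : ℝ) ^ 2) D := by
    refine integrable_of_measurable_of_abs_le ((h.measurable_inner v).pow_const 2)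
      (K := (‖v‖ * C) ^ 2) fun z => ?_
    rw [abs_pow]
    exact pow_le_pow_left₀ (abs_nonneg _) (h.abs_inner_le v z) 2
  have i4 : Integrable (fun z => residual ψ y θ z ^ 2
      - 2 * (residual ψ y θ z * inner ℝ v (ψ z))) D := i1.sub (i2.const_mul 2)
  rw [h.inner_secondMoment_self, meanGradient,
    h.inner_integral_smul (h.measurable_residual θ) (h.abs_residual_le le_rfl),
    ← integral_const_mul, ← integral_sub i1 (i2.const_mul 2),
    ← integral_add i4 i3]
  refine integral_congr_ae (ae_of_all _ fun z => ?_)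
  simp only [residual, inner_sub_left]
  ring

/-- Nonnegativity of the mean square residual at θ - v. It says that the gradient is controlled by
the residual in the dual norm of H, and is tested below on well-chosen v. -/
theorem two_mul_inner_meanGradient_le (h : IsBoundedRegression ψ y C Y) (θ v : E) :
    2 * inner ℝ v (meanGradient D ψ y θ)
      ≤ ∫ z, residual ψ y θ z ^ 2 ∂D + inner ℝ v (secondMoment D ψ v) := by
  have h1 := h.integral_sq_residual_sub (D := D) θ v
  have h2 : 0 ≤ ∫ z, residual ψ y (θ - v) z ^ 2 ∂D := integral_nonneg fun _ => sq_nonneg _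
  linarith

theorem inner_secondMoment_self_le (h : IsBoundedRegression ψ y C Y) (v : E) :
    inner ℝ v (secondMoment D ψ v) ≤ C ^ 2 * ‖v‖ ^ 2 := by
  have h1 := h.norm_sq_secondMoment_le (D := D) v
  have h2 := real_inner_le_norm v (secondMoment D ψ v)
  have h3 : 0 ≤ inner ℝ v (secondMoment D ψ v) := by
    rw [h.inner_secondMoment_self]; exact integral_nonneg fun _ => sq_nonneg _
  rcases h3.eq_or_lt with h4 | h4
  · rw [← h4]; positivity
  · have h5 : inner ℝ v (secondMoment D ψ v) ^ 2
        ≤ ‖v‖ ^ 2 * (C ^ 2 * inner ℝ v (secondMoment D ψ v)) :=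
      calc inner ℝ v (secondMoment D ψ v) ^ 2 ≤ (‖v‖ * ‖secondMoment D ψ v‖) ^ 2 := by gcongr
        _ = ‖v‖ ^ 2 * ‖secondMoment D ψ v‖ ^ 2 := by ring
        _ ≤ _ := by gcongr
    nlinarith

theorem integral_sq_residual_gdIterate_antitone (h : IsBoundedRegression ψ y C Y) {η : ℝ}
    (hη : 0 ≤ η) (hηC : η * C ^ 2 ≤ 1) :
    Antitone fun t => ∫ z, residual ψ y (gdIterate D ψ y η t) z ^ 2 ∂D := by
  refine antitone_nat_of_succ_le fun t => ?_
  simp only [gdIterate]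
  set γ := meanGradient D ψ y (gdIterate D ψ y η t)
  rw [h.integral_sq_residual_sub, map_smul]
  simp only [inner_smul_left, inner_smul_right, RCLike.conj_to_real]
  have h1 := h.inner_secondMoment_self_le (D := D) γ
  have h2 : inner ℝ γ γ = ‖γ‖ ^ 2 := real_inner_self_eq_norm_sq γ
  change _ - 2 * (η * inner ℝ γ γ) + _ ≤ _
  rw [h2]
  have h3 : η * (η * inner ℝ γ (secondMoment D ψ γ)) ≤ η * ‖γ‖ ^ 2 := by
    refine mul_le_mul_of_nonneg_left ?_ hη
    calc η * inner ℝ γ (secondMoment D ψ γ) ≤ η * (C ^ 2 * ‖γ‖ ^ 2) := by gcongr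
      _ = (η * C ^ 2) * ‖γ‖ ^ 2 := by ring
      _ ≤ 1 * ‖γ‖ ^ 2 := by gcongr
      _ = _ := one_mul _
  have h4 : 0 ≤ η * ‖γ‖ ^ 2 := by positivity
  linarith

/-- By convexity the gradient term gains η (R(θ) - R(w)), where R is the mean square residual. The
quadratic term costs at most half of η R(θ), since ‖∇‖² ≤ C² R(θ) and ηC² ≤ 1/2. -/
theorem norm_sq_gdIterate_succ_sub_le (h : IsBoundedRegression ψ y C Y) {η : ℝ} (hη : 0 ≤ η)
    (hηC : η * C ^ 2 ≤ 1 / 2) (w : E) (t : ℕ) :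
    ‖gdIterate D ψ y η (t + 1) - w‖ ^ 2 ≤ ‖gdIterate D ψ y η t - w‖ ^ 2
      - η / 2 * ∫ z, residual ψ y (gdIterate D ψ y η t) z ^ 2 ∂D
      + η * ∫ z, residual ψ y w z ^ 2 ∂D := by
  set θ := gdIterate D ψ y η t with hθ
  set R := ∫ z, residual ψ y θ z ^ 2 ∂D with hR
  have h1 := h.integral_sq_residual_sub (D := D) θ (θ - w)
  rw [sub_sub_cancel] at h1
  have h0 : 0 ≤ inner ℝ (θ - w) (secondMoment D ψ (θ - w)) := by
    rw [h.inner_secondMoment_self]; exact integral_nonneg fun _ => sq_nonneg _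
  have h2 : ‖meanGradient D ψ y θ‖ ^ 2 ≤ C ^ 2 * R :=
    h.norm_sq_integral_smul_le (h.measurable_residual θ) (h.abs_residual_le le_rfl)
  have hR0 : 0 ≤ R := integral_nonneg fun _ => sq_nonneg _
  have h3 : ‖gdIterate D ψ y η (t + 1) - w‖ ^ 2 = ‖θ - w‖ ^ 2
      - 2 * (η * inner ℝ (θ - w) (meanGradient D ψ y θ)) + η ^ 2 * ‖meanGradient D ψ y θ‖ ^ 2 := by
    simp only [gdIterate]
    rw [← hθ, sub_right_comm, norm_sub_sq_real, inner_smul_right, norm_smul, mul_pow,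
      Real.norm_eq_abs, sq_abs]
  have h4 : η ^ 2 * ‖meanGradient D ψ y θ‖ ^ 2 ≤ η / 2 * R := by
    calc η ^ 2 * ‖meanGradient D ψ y θ‖ ^ 2 ≤ η ^ 2 * (C ^ 2 * R) := by gcongr
      _ = η * C ^ 2 * (η * R) := by ring
      _ ≤ 1 / 2 * (η * R) := by gcongr
      _ = _ := by ring
  have h5 : R - ∫ z, residual ψ y w z ^ 2 ∂D ≤ 2 * inner ℝ (θ - w) (meanGradient D ψ y θ) := by
    linarith
  have h6 := mul_le_mul_of_nonneg_left h5 hη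
  rw [h3]
  linarith

/-- The potential inequality is summed from θ_0 = 0, where the potential is ‖w‖². As the residual
decreases along gradient descent, the last one is at most the average. -/
theorem integral_sq_residual_gdIterate_le (h : IsBoundedRegression ψ y C Y) {η : ℝ} (hη : 0 < η)
    (hηC : η * C ^ 2 ≤ 1 / 2) (w : E) {T : ℕ} (hT : 0 < T) :
    ∫ z, residual ψ y (gdIterate D ψ y η T) z ^ 2 ∂D
      ≤ 2 * ‖w‖ ^ 2 / (η * T) + 2 * ∫ z, residual ψ y w z ^ 2 ∂D := by
  have h1 : ∀ n : ℕ, η / 2 * ∑ t ∈ Finset.range n,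
      ∫ z, residual ψ y (gdIterate D ψ y η t) z ^ 2 ∂D
        ≤ ‖w‖ ^ 2 - ‖gdIterate D ψ y η n - w‖ ^ 2 + n * (η * ∫ z, residual ψ y w z ^ 2 ∂D) := by
    intro n
    induction n with
    | zero => simp [gdIterate]
    | succ n ih =>
      have := h.norm_sq_gdIterate_succ_sub_le (D := D) hη.le hηC w n
      rw [Finset.sum_range_succ, mul_add]
      push_cast
      linarith
  have h2 : T * ∫ z, residual ψ y (gdIterate D ψ y η T) z ^ 2 ∂D
      ≤ ∑ t ∈ Finset.range T, ∫ z, residual ψ y (gdIterate D ψ y η t) z ^ 2 ∂D := by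
    have hsum := Finset.card_nsmul_le_sum (Finset.range T)
      (fun t => ∫ z, residual ψ y (gdIterate D ψ y η t) z ^ 2 ∂D) _
      fun t ht => h.integral_sq_residual_gdIterate_antitone hη.le (by linarith)
        (Finset.mem_range.1 ht).le
    rwa [Finset.card_range, nsmul_eq_mul] at hsum
  have hT' : (0 : ℝ) < T := by exact_mod_cast hT
  have h3 := mul_le_mul_of_nonneg_left h2 (by positivity : 0 ≤ η / 2)
  have h4 := h1 T
  have h5 := sq_nonneg ‖gdIterate D ψ y η T - w‖
  rw [div_add' _ _ _ (by positivity), le_div_iff₀ (by positivity)]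
  nlinarith

/-- The comparator w need not be a fixed point of the affine iteration. The distance to it splits
into the decaying initial error and the response to the constant force given by the gradient at w.
-/
theorem gdIterate_sub_eq (h : IsBoundedRegression ψ y C Y) (η : ℝ) (w : E) (t : ℕ) :
    gdIterate D ψ y η t - w = -((gdOperator D ψ η ^ t) w)
      - η • ∑ k ∈ Finset.range t, (gdOperator D ψ η ^ k) (meanGradient D ψ y w) := by
  induction t with
  | zero => simp [gdIterate]
  | succ t ih =>
    have h1 : gdIterate D ψ y η (t + 1) - w
        = gdOperator D ψ η (gdIterate D ψ y η t - w) - η • meanGradient D ψ y w := by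
      simp only [gdIterate, gdOperator, sub_apply, smul_apply, ContinuousLinearMap.id_apply]
      rw [← h.meanGradient_sub, smul_sub]
      abel
    rw [h1, ih, Finset.sum_range_succ', map_sub, map_neg, map_smul, map_sum]
    simp only [pow_succ' _ (_ : ℕ), mul_apply_eq_comp, pow_zero, one_apply_eq_self, smul_add]
    abel

/-- A maximal inequality for the part of gradient descent that is driven by a misspecification:
its square at `z` is at most the mean square misspecification times a leverage score. -/
theorem exists_leverage (h : IsBoundedRegression ψ y C Y) {η : ℝ} (hη : 0 ≤ η)
    (hηC : η * C ^ 2 ≤ 1) (w : E) :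
    ∃ κ : Z → ℝ, Integrable κ D ∧ ∫ z, κ z ∂D ≤ Module.finrank ℝ E ∧ ∀ t z,
      inner ℝ (η • ∑ k ∈ Finset.range t, (gdOperator D ψ η ^ k) (meanGradient D ψ y w)) (ψ z) ^ 2
        ≤ (∫ z, residual ψ y w z ^ 2 ∂D) * κ z := by
  set g := meanGradient D ψ y w with hg
  set Δ := ∫ z, residual ψ y w z ^ 2 ∂D with hΔ
  have hsymm : ((secondMoment D ψ : E →L[ℝ] E) : E →ₗ[ℝ] E).IsSymmetric :=
    fun x z => h.secondMoment_symm z x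
  obtain ⟨n, hn⟩ : ∃ n, Module.finrank ℝ E = n := ⟨_, rfl⟩
  set v := hsymm.eigenvectorBasis hn with hv
  set l := hsymm.eigenvalues hn with hl
  have hHv : ∀ j, secondMoment D ψ (v j) = l j • v j := fun j =>
    hsymm.apply_eigenvectorBasis hn j
  have hnorm : ∀ j, ‖v j‖ = 1 := v.orthonormal.norm_eq_one
  have hlv : ∀ j, l j = inner ℝ (v j) (secondMoment D ψ (v j)) := fun j => by
    rw [hHv, inner_smul_right, real_inner_self_eq_norm_sq, hnorm]; simp
  have hl0 : ∀ j, 0 ≤ l j := fun j => by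
    rw [hlv, h.inner_secondMoment_self]; exact integral_nonneg fun _ => sq_nonneg _
  have hlC : ∀ j, η * l j ≤ 1 := fun j => by
    have h1 := h.inner_secondMoment_self_le (D := D) (v j)
    rw [← hlv, hnorm, one_pow, mul_one] at h1
    exact (mul_le_mul_of_nonneg_left h1 hη).trans hηC
  have hAv : ∀ k j, (gdOperator D ψ η ^ k) (v j) = (1 - η * l j) ^ k • v j := by
    intro k j
    induction k with
    | zero => simp
    | succ k ih =>
      have h1 : gdOperator D ψ η (v j) = (1 - η * l j) • v j := by
        simp only [gdOperator, sub_apply, smul_apply, ContinuousLinearMap.id_apply]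
        rw [hHv, sub_smul, one_smul, smul_smul]
      rw [pow_succ', mul_apply_eq_comp, ih, map_smul, h1, smul_smul, pow_succ]
  -- components of the mean gradient in degenerate directions vanish
  have hg0 : ∀ j, l j = 0 → inner ℝ (v j) g = 0 := by
    intro j hj
    by_contra hne
    -- Along a null direction the quadratic term vanishes, so scaling can make the linear term as
    -- large as desired; this scale yields Δ + 1 ≤ Δ.
    have h1 := h.two_mul_inner_meanGradient_le (D := D) w (((Δ + 1) / (2 * inner ℝ (v j) g)) • v j)
    rw [map_smul, hHv, hj, zero_smul, smul_zero, inner_zero_right, inner_smul_left,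
      RCLike.conj_to_real, ← hg, ← hΔ] at h1
    have h2 : 2 * ((Δ + 1) / (2 * inner ℝ (v j) g) * inner ℝ (v j) g) = Δ + 1 := by field_simp
    linarith
  have hBessel : ∑ j, inner ℝ (v j) g ^ 2 / l j ≤ Δ := by
    -- `u` is the pseudo-inverse of H applied to g: division by zero gives 0 in degenerate
    -- directions, where g has no component. Thus H u = g, and testing with `u` gives 2⟨u, g⟩ ≤ Δ +
    -- ⟨u, g⟩.
    set u : E := ∑ j, (inner ℝ (v j) g / l j) • v j with hu
    have h1 : inner ℝ u g = ∑ j, inner ℝ (v j) g ^ 2 / l j := by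
      rw [hu, sum_inner]
      refine Finset.sum_congr rfl fun j _ => ?_
      rw [inner_smul_left, RCLike.conj_to_real]; ring
    have h2 : secondMoment D ψ u = ∑ j, inner ℝ (v j) g • v j := by
      rw [hu, map_sum]
      refine Finset.sum_congr rfl fun j _ => ?_
      rw [map_smul, hHv, smul_smul]
      by_cases hj : l j = 0
      · rw [hg0 j hj]; simp
      · rw [div_mul_cancel₀ _ hj]
    have h3 : secondMoment D ψ u = g := by
      rw [h2]; exact v.sum_repr' g
    have h4 := h.two_mul_inner_meanGradient_le (D := D) w u
    rw [h3, ← hg, h1, ← hΔ] at h4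
    linarith
  have hi : ∀ j, Integrable (fun z => (inner ℝ (v j) (ψ z) : ℝ) ^ 2 / l j) D := fun j => by
    refine Integrable.div_const ?_ _
    refine integrable_of_measurable_of_abs_le ((h.measurable_inner (v j)).pow_const 2)
      (K := (‖v j‖ * C) ^ 2) fun z => ?_
    rw [abs_pow]
    exact pow_le_pow_left₀ (abs_nonneg _) (h.abs_inner_le (v j) z) 2
  -- The leverage score ⟨ψ, H⁺ψ⟩ with H⁺ the pseudo-inverse. Each direction has integral l_j / l_j,
  -- which is 1, or 0 if degenerate, so the total is at most the dimension.
  refine ⟨fun z => ∑ j, inner ℝ (v j) (ψ z) ^ 2 / l j, integrable_finsetSum _ fun j _ => hi j,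
    ?_, fun t z => ?_⟩
  · rw [integral_finsetSum _ fun j _ => hi j, hn]
    have h1 : ∀ j ∈ (Finset.univ : Finset (Fin n)),
        ∫ z, (inner ℝ (v j) (ψ z) : ℝ) ^ 2 / l j ∂D ≤ 1 := fun j _ => by
      rw [integral_div, ← h.inner_secondMoment_self, ← hlv]
      exact div_self_le_one _
    simpa using Finset.sum_le_sum h1
  -- `c j` is the gain of the accumulated response in eigendirection j. It is at most 1 / l_j
  -- uniformly in t, because c_j l_j = 1 - (1 - η l_j)^t lies in [0, 1].
  · set c : Fin n → ℝ := fun j => η * ∑ k ∈ Finset.range t, (1 - η * l j) ^ k with hc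
    have hc1 : ∀ j, c j * l j = 1 - (1 - η * l j) ^ t := fun j => by
      rw [← mul_neg_geom_sum (1 - η * l j) t, hc]; ring
    have hc2 : ∀ j, (c j * l j) ^ 2 ≤ 1 := fun j => by
      have h1 : 0 ≤ (1 - η * l j) ^ t := pow_nonneg (by linarith [hlC j]) t
      have h2 : (1 - η * l j) ^ t ≤ 1 :=
        pow_le_one₀ (by linarith [hlC j]) (by linarith [mul_nonneg hη (hl0 j)])
      rw [hc1]
      nlinarith
    -- The eigenvalue is split evenly as √l_j · √l_j, so that Cauchy–Schwarz separates the misfit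
    -- (`hBessel`) from the leverage score.
    have h1 : inner ℝ (η • ∑ k ∈ Finset.range t, (gdOperator D ψ η ^ k) g) (ψ z)
        = ∑ j, (inner ℝ (v j) g / √(l j)) * ((c j * l j) * inner ℝ (v j) (ψ z) / √(l j)) := by
      rw [← v.sum_inner_mul_inner]
      refine Finset.sum_congr rfl fun j _ => ?_
      have h2 : inner ℝ (η • ∑ k ∈ Finset.range t, (gdOperator D ψ η ^ k) g) (v j)
          = c j * inner ℝ (v j) g := by
        rw [inner_smul_left, sum_inner, RCLike.conj_to_real, hc, mul_assoc, Finset.sum_mul]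
        congr 1
        refine Finset.sum_congr rfl fun k _ => ?_
        rw [h.gdOperator_pow_symm, hAv, inner_smul_right, real_inner_comm]
      rw [h2]
      by_cases hj : l j = 0
      · rw [hg0 j hj]; simp
      · have hs : √(l j) ≠ 0 := Real.sqrt_ne_zero'.2 ((hl0 j).lt_of_ne (Ne.symm hj))
        have hs2 : √(l j) ^ 2 = l j := Real.sq_sqrt (hl0 j)
        field_simp
        rw [hs2]
    rw [h1]
    refine (Finset.sum_mul_sq_le_sq_mul_sq _ _ _).trans ?_
    refine mul_le_mul ?_ ?_ (Finset.sum_nonneg fun j _ => sq_nonneg _)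
      (integral_nonneg fun _ => sq_nonneg _)
    · refine le_trans (le_of_eq ?_) hBessel
      refine Finset.sum_congr rfl fun j _ => ?_
      rw [div_pow, Real.sq_sqrt (hl0 j)]
    · refine Finset.sum_le_sum fun j _ => ?_
      rw [div_pow, Real.sq_sqrt (hl0 j), mul_pow]
      refine div_le_div_of_nonneg_right ?_ (hl0 j)
      exact mul_le_of_le_one_left (sq_nonneg _) (hc2 j)

/-- The mean square residual after `T` steps of least mean squares, in terms of the norm and the
residual of an arbitrary comparator `w`. -/
theorem integral_meanSqResidual_le_of_comparator (h : IsBoundedRegression ψ y C Y) {η : ℝ}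
    (hη : 0 < η) (hηC : η * C ^ 2 ≤ 1 / 4) {B : ℕ} (hB : 1 ≤ B) {T : ℕ} (hT : 0 < T) (w : E) :
    ∫ z, meanSqResidual D ψ y η B T z ∂D
      ≤ 4 * ‖w‖ ^ 2 / (η * T) + 4 * ∫ z, residual ψ y w z ^ 2 ∂D
        + 24 * (η * C ^ 2) * (C ^ 2 * ‖w‖ ^ 2
          + (Module.finrank ℝ E + 1) * ∫ z, residual ψ y w z ^ 2 ∂D) := by
  obtain ⟨κ, hκi, hκ, hκle⟩ := h.exists_leverage (D := D) hη.le (by linarith) w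
  set Δ := ∫ z, residual ψ y w z ^ 2 ∂D with hΔ
  have hδ := h.integrable_sq_residual (D := D) w
  have hΔ0 : 0 ≤ Δ := integral_nonneg fun _ => sq_nonneg _
  -- A majorant independent of t: the square of the sum of the three parts of the residual (initial
  -- error, response to the misfit, residual of w) is at most 3 times the sum of their squares.
  set β : Z → ℝ := fun z => 3 * (C ^ 2 * ‖w‖ ^ 2 + (Δ * κ z + residual ψ y w z ^ 2)) with hβ
  have iβ : Integrable (fun z => Δ * κ z + residual ψ y w z ^ 2) D := (hκi.const_mul Δ).add hδ
  have hβi : Integrable β D := ((integrable_const _).add iβ).const_mul 3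
  have hβint : ∫ z, β z ∂D ≤ 3 * (C ^ 2 * ‖w‖ ^ 2 + (Module.finrank ℝ E + 1) * Δ) := by
    rw [hβ, integral_const_mul, integral_add (integrable_const _) iβ,
      integral_add (hκi.const_mul Δ) hδ, integral_const_mul Δ κ, ← hΔ]
    simp only [integral_const, probReal_univ, smul_eq_mul, one_mul]
    have := mul_le_mul_of_nonneg_left hκ hΔ0
    linarith
  have hmax : ∀ t ≤ T, ∀ z, residual ψ y (gdIterate D ψ y η t) z ^ 2 ≤ β z := by
    intro t _ z
    set a : ℝ := inner ℝ ((gdOperator D ψ η ^ t) w) (ψ z) with ha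
    set b : ℝ := inner ℝ (η • ∑ k ∈ Finset.range t,
      (gdOperator D ψ η ^ k) (meanGradient D ψ y w)) (ψ z) with hb
    have h1 : residual ψ y (gdIterate D ψ y η t) z = -a - b + residual ψ y w z := by
      have h2 : inner ℝ (gdIterate D ψ y η t - w) (ψ z) = -a - b := by
        rw [h.gdIterate_sub_eq, inner_sub_left, inner_neg_left]
      rw [inner_sub_left] at h2
      unfold residual
      linarith
    have h2 : a ^ 2 ≤ C ^ 2 * ‖w‖ ^ 2 := by
      rw [← sq_abs, ← mul_pow, mul_comm C]
      refine pow_le_pow_left₀ (abs_nonneg _) ((h.abs_inner_le _ z).trans ?_) 2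
      exact mul_le_mul_of_nonneg_right (h.norm_gdOperator_pow_le hη.le (by linarith) t w)
        ((norm_nonneg _).trans (h.norm_feature_le z))
    have h3 : b ^ 2 ≤ Δ * κ z := hκle t z
    rw [h1]
    simp only [hβ]
    nlinarith [sq_nonneg (a - b), sq_nonneg (a + residual ψ y w z),
      sq_nonneg (b + residual ψ y w z)]
  have h1 := h.integral_meanSqResidual_le hη.le hηC hB T hβi hmax
  have h2 := h.integral_sq_residual_gdIterate_le (D := D) hη (by linarith) w hT
  have h3 : 8 * (η * C ^ 2) * ∫ z, β z ∂D
      ≤ 8 * (η * C ^ 2) * (3 * (C ^ 2 * ‖w‖ ^ 2 + (Module.finrank ℝ E + 1) * Δ)) :=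
    mul_le_mul_of_nonneg_left hβint (by positivity)
  calc _ ≤ _ := h1
    _ ≤ 2 * (2 * ‖w‖ ^ 2 / (η * T) + 2 * Δ)
        + 8 * (η * C ^ 2) * (3 * (C ^ 2 * ‖w‖ ^ 2 + (Module.finrank ℝ E + 1) * Δ)) :=
      add_le_add (mul_le_mul_of_nonneg_left h2 (by norm_num)) h3
    _ = _ := by ring

end IsBoundedRegression

end GradientDescent

/-! ### Stochastic gradient descent on random features -/

section Features

variable {d m : ℕ}

/-- The features of the last layer as a function of the sample. -/
noncomputable def scaledFeature (σ : ℝ → ℝ) (U : Fin m → EuclideanSpace ℝ (Fin d))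
    (z : EuclideanSpace ℝ (Fin d) × ℝ) : EuclideanSpace ℝ (Fin m) :=
  (1 / √(m : ℝ)) • featureMap σ U z.1

theorem network_eq_inner (σ : ℝ → ℝ) (U : Fin m → EuclideanSpace ℝ (Fin d))
    (θ : EuclideanSpace ℝ (Fin m)) (z : EuclideanSpace ℝ (Fin d) × ℝ) :
    network σ U θ z.1 = inner ℝ θ (scaledFeature σ U z) := by
  rw [network, scaledFeature, inner_smul_right]

theorem gradient_sampleLoss (σ : ℝ → ℝ) (U : Fin m → EuclideanSpace ℝ (Fin d))
    (z : EuclideanSpace ℝ (Fin d) × ℝ) (θ : EuclideanSpace ℝ (Fin m)) :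
    gradient (fun θ' => sampleLoss (network σ U θ') z) θ
      = residual (scaledFeature σ U) Prod.snd θ z • scaledFeature σ U z := by
  refine HasGradientAt.gradient ?_
  set φ := scaledFeature σ U z
  have h1 : (fun θ' => sampleLoss (network σ U θ') z)
      = fun θ' => 1 / 2 * (innerSL ℝ φ θ' - z.2) ^ 2 := by
    funext θ'
    rw [sampleLoss, network_eq_inner, innerSL_apply_apply, real_inner_comm]
  rw [h1, hasGradientAt_iff_hasFDerivAt]
  have h2 := ((((innerSL ℝ φ).hasFDerivAt (x := θ)).sub_const z.2).pow 2).const_mul (1 / 2 : ℝ)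
  refine h2.congr_fderiv ?_
  ext v
  simp only [residual, InnerProductSpace.toDual_apply_apply, inner_smul_left, smul_apply,
    innerSL_apply_apply, smul_eq_mul, RCLike.conj_to_real, nsmul_eq_mul]
  rw [real_inner_comm φ θ]
  push_cast
  ring

theorem sgdIterate_eq_lmsIterate (σ : ℝ → ℝ) (U : Fin m → EuclideanSpace ℝ (Fin d)) (η : ℝ)
    {B : ℕ} (ω : ℕ → Fin B → EuclideanSpace ℝ (Fin d) × ℝ) (t : ℕ) :
    sgdIterate σ U η ω t = lmsIterate (scaledFeature σ U) Prod.snd η ω t := by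
  induction t with
  | zero => rfl
  | succ t ih => simp only [sgdIterate, lmsIterate, sgdStep, lmsStep, ih, gradient_sampleLoss]

theorem lmsIterate_congr {Z E : Type*} [NormedAddCommGroup E] [InnerProductSpace ℝ E]
    {ψ ψ' : Z → E} {y y' : Z → ℝ} {B : ℕ} {ω : ℕ → Fin B → Z}
    (hψ : ∀ t b, ψ (ω t b) = ψ' (ω t b)) (hy : ∀ t b, y (ω t b) = y' (ω t b)) (η : ℝ) (t : ℕ) :
    lmsIterate ψ y η ω t = lmsIterate ψ' y' η ω t := by
  induction t with
  | zero => rfl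
  | succ t ih => simp only [lmsIterate, lmsStep, residual, ih, hψ, hy]

section Measurability

variable {Ω : Type*} [MeasurableSpace Ω] {σ : ℝ → ℝ} {U : Ω → Fin m → EuclideanSpace ℝ (Fin d)}

theorem measurable_featureMap (hσ : Measurable σ) (hU : Measurable U)
    {x : Ω → EuclideanSpace ℝ (Fin d)} (hx : Measurable x) :
    Measurable fun a => featureMap σ (U a) (x a) := by
  unfold featureMap
  refine (PiLp.continuous_toLp 2 _).measurable.comp (measurable_pi_lambda _ fun i => ?_)
  exact hσ.comp (((measurable_pi_apply i).comp hU).inner hx)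

theorem measurable_scaledFeature (hσ : Measurable σ) (hU : Measurable U)
    {z : Ω → EuclideanSpace ℝ (Fin d) × ℝ} (hz : Measurable z) :
    Measurable fun a => scaledFeature σ (U a) (z a) :=
  (measurable_featureMap hσ hU hz.fst).const_smul (1 / √(m : ℝ))

theorem measurable_network (hσ : Measurable σ) (hU : Measurable U)
    {θ : Ω → EuclideanSpace ℝ (Fin m)} (hθ : Measurable θ)
    {x : Ω → EuclideanSpace ℝ (Fin d)} (hx : Measurable x) :
    Measurable fun a => network σ (U a) (θ a) (x a) :=
  (hθ.inner (measurable_featureMap hσ hU hx)).const_mul _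

theorem measurable_sgdIterate (hσ : Measurable σ) (hU : Measurable U) (η : ℝ) {B : ℕ}
    {s : Ω → ℕ → Fin B → EuclideanSpace ℝ (Fin d) × ℝ} (hs : Measurable s) (t : ℕ) :
    Measurable fun a => sgdIterate σ (U a) η (s a) t := by
  simp only [sgdIterate_eq_lmsIterate]
  induction t with
  | zero => exact measurable_const
  | succ t ih =>
    simp only [lmsIterate, lmsStep]
    refine ih.sub (Measurable.fun_const_smul (Finset.measurable_sum _ fun b _ => ?_) _)
    have h1 : Measurable fun a => s a t b :=
      (measurable_pi_apply b).comp ((measurable_pi_apply t).comp hs)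
    have h2 := measurable_scaledFeature hσ hU h1
    exact ((ih.inner h2).sub h1.snd).smul h2

end Measurability

theorem norm_scaledFeature_le {σ : ℝ → ℝ} (hm : 1 ≤ m) {U : Fin m → EuclideanSpace ℝ (Fin d)}
    {z : EuclideanSpace ℝ (Fin d) × ℝ} {C : ℝ} (h : ∀ i, |σ (inner ℝ (U i) z.1)| ≤ C) :
    ‖scaledFeature σ U z‖ ≤ C := by
  have hm' : (0 : ℝ) < m := by exact_mod_cast hm
  have hC : 0 ≤ C := (abs_nonneg _).trans (h ⟨0, hm⟩)
  refine (sq_le_sq₀ (norm_nonneg _) hC).1 ?_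
  rw [scaledFeature, norm_smul, mul_pow, Real.norm_eq_abs, sq_abs, div_pow, one_pow,
    Real.sq_sqrt hm'.le, EuclideanSpace.norm_sq_eq, div_mul_eq_mul_div, one_mul,
    div_le_iff₀ hm']
  have h1 : ∀ i ∈ (Finset.univ : Finset (Fin m)), ‖featureMap σ U z.1 i‖ ^ 2 ≤ C ^ 2 :=
    fun i _ => pow_le_pow_left₀ (norm_nonneg _) (h i) 2
  refine (Finset.sum_le_sum h1).trans_eq ?_
  simp [mul_comm]

/-- The second-layer weights `ν(u_i) / √m`. -/
noncomputable def sampledWeights (ν : EuclideanSpace ℝ (Fin d) → ℝ)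
    (U : Fin m → EuclideanSpace ℝ (Fin d)) : EuclideanSpace ℝ (Fin m) :=
  WithLp.toLp 2 fun i => ν (U i) / √(m : ℝ)

theorem norm_sq_sampledWeights_le {ν : EuclideanSpace ℝ (Fin d) → ℝ} (hm : 1 ≤ m)
    {U : Fin m → EuclideanSpace ℝ (Fin d)} {M : ℝ} (h : ∀ i, |ν (U i)| ≤ M) :
    ‖sampledWeights ν U‖ ^ 2 ≤ M ^ 2 := by
  have hm' : (0 : ℝ) < m := by exact_mod_cast hm
  rw [EuclideanSpace.norm_sq_eq]
  have h1 : ∀ i ∈ (Finset.univ : Finset (Fin m)), ‖sampledWeights ν U i‖ ^ 2 ≤ M ^ 2 / m :=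
    fun i _ => by
      simp only [sampledWeights, norm_div, Real.norm_eq_abs, div_pow, sq_abs]
      rw [Real.sq_sqrt hm'.le, ← sq_abs (ν (U i))]
      exact div_le_div_of_nonneg_right (pow_le_pow_left₀ (abs_nonneg _) (h i) 2) hm'.le
  refine (Finset.sum_le_sum h1).trans_eq ?_
  simp only [Finset.sum_const, Finset.card_univ, Fintype.card_fin, nsmul_eq_mul]
  field_simp

/-- The two factors 1/√m, of the weights and of the features, combine to the 1/m of a Monte Carlo
average, whose mean over `U` is the infinite-width network. -/
theorem inner_sampledWeights (σ : ℝ → ℝ) (ν : EuclideanSpace ℝ (Fin d) → ℝ)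
    (U : Fin m → EuclideanSpace ℝ (Fin d)) (z : EuclideanSpace ℝ (Fin d) × ℝ) :
    inner ℝ (sampledWeights ν U) (scaledFeature σ U z)
      = sampleMean m (fun u => σ (inner ℝ u z.1) * ν u) U := by
  rw [scaledFeature, inner_smul_right, PiLp.inner_apply, sampleMean, Finset.mul_sum,
    Finset.mul_sum]
  refine Finset.sum_congr rfl fun i _ => ?_
  have h1 : (1 / √(m : ℝ)) * (1 / √(m : ℝ)) = 1 / m := by
    rw [div_mul_div_comm, one_mul, Real.mul_self_sqrt (Nat.cast_nonneg m)]
  simp only [sampledWeights, featureMap, RCLike.inner_apply, conj_trivial]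
  rw [← h1]
  ring

/-- The infinite-width network with second-layer weight function `ν`. -/
noncomputable def infiniteNetwork (σ : ℝ → ℝ) (𝓤 : Measure (EuclideanSpace ℝ (Fin d)))
    (ν : EuclideanSpace ℝ (Fin d) → ℝ) (x : EuclideanSpace ℝ (Fin d)) : ℝ :=
  ∫ u, σ (inner ℝ u x) * ν u ∂𝓤

theorem measurable_infiniteNetwork {σ : ℝ → ℝ} (hσ : Measurable σ)
    {ν : EuclideanSpace ℝ (Fin d) → ℝ} (hν : Measurable ν)
    (𝓤 : Measure (EuclideanSpace ℝ (Fin d))) [SFinite 𝓤] :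
    Measurable (infiniteNetwork σ 𝓤 ν) := by
  unfold infiniteNetwork
  have h : Measurable fun p : EuclideanSpace ℝ (Fin d) × EuclideanSpace ℝ (Fin d) =>
      σ (inner ℝ p.2 p.1) * ν p.2 := by fun_prop
  exact h.stronglyMeasurable.integral_prod_right'.measurable

end Features

/-! ### Data distributions -/

section Data

variable {d : ℕ} {X : Set (EuclideanSpace ℝ (Fin d))}
  {D Dval : Measure (EuclideanSpace ℝ (Fin d) × ℝ)}

theorem IsDataDistribution.ae_mem (hD : IsDataDistribution X D) (hX : MeasurableSet X) :
    ∀ᵐ z ∂D, z.1 ∈ X := by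
  obtain ⟨p, -, hp⟩ := hD.exists_density
  refine ae_of_ae_map (f := Prod.fst) measurable_fst.aemeasurable (p := fun x => x ∈ X) ?_
  change ∀ᵐ x ∂(inputMarginal D), x ∈ X
  rw [hp]
  exact (withDensity_absolutelyContinuous _ _).ae_le (ae_restrict_mem hX)

/-- By compactness the validation density has a maximum and the training density a positive minimum;
their quotient is the constant. This is how training error controls validation error. -/
theorem exists_inputMarginal_le (hX : IsCompact X) (hval : IsDataDistribution X Dval)
    (hD : ∃ p, HasContinuousDensity X D p ∧ ∀ x ∈ X, 0 < p x) :
    ∃ κ : ℝ≥0, inputMarginal Dval ≤ (κ : ℝ≥0∞) • inputMarginal D := by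
  obtain ⟨q, hqc, hq⟩ := hval.exists_density
  obtain ⟨p, ⟨hpc, hp⟩, hp0⟩ := hD
  rcases X.eq_empty_or_nonempty with rfl | hne
  · refine ⟨0, ?_⟩
    rw [hq]; simp
  obtain ⟨x₀, hx₀, hmin⟩ := hX.exists_isMinOn hne hpc
  obtain ⟨x₁, hx₁, hmax⟩ := hX.exists_isMaxOn hne hqc
  refine ⟨q x₁ / p x₀, ?_⟩
  rw [hq, hp, ← withDensity_smul' _ _ ENNReal.coe_ne_top]
  refine withDensity_mono (ae_restrict_of_forall_mem hX.measurableSet fun x hx => ?_)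
  simp only [Pi.smul_apply, smul_eq_mul]
  rw [← ENNReal.coe_mul, ENNReal.coe_le_coe]
  calc q x ≤ q x₁ := hmax hx
    _ = q x₁ / p x₀ * p x₀ := (div_mul_cancel₀ _ (hp0 x₀ hx₀).ne').symm
    _ ≤ q x₁ / p x₀ * p x := mul_le_mul_of_nonneg_left (hmin hx) zero_le

theorem ae_streamLaw {Z : Type*} [MeasurableSpace Z] {D : Measure Z} [IsProbabilityMeasure D]
    {p : Z → Prop} (h : ∀ᵐ z ∂D, p z) (B : ℕ) : ∀ᵐ ω ∂(streamLaw D B), ∀ t b, p (ω t b) := by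
  rw [ae_all_iff]
  intro t
  have h1 : ∀ᵐ x ∂(Measure.pi fun _ : Fin B => D), ∀ b, p (x b) := by
    rw [ae_all_iff]
    exact fun b => (measurePreserving_eval (fun _ : Fin B => D) b).quasiMeasurePreserving.ae h
  exact (measurePreserving_eval_infinitePi
    (fun _ : ℕ => Measure.pi fun _ : Fin B => D) t).quasiMeasurePreserving.ae h1

/-- With a = h - f and c = f - y, the losses differ by a²/2 + ac, and Young's inequality with weight
ε treats the cross term. The validation labels may be noisy, so c cannot be taken small and must be
paid for by ε. -/
theorem abs_expectedLoss_sub_le {f h : EuclideanSpace ℝ (Fin d) → ℝ}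
    (hf : MemLp (fun z : EuclideanSpace ℝ (Fin d) × ℝ => f z.1 - z.2) 2 D)
    (hh : MemLp (fun z : EuclideanSpace ℝ (Fin d) × ℝ => h z.1 - f z.1) 2 D) {ε : ℝ} (hε : 0 < ε) :
    |expectedLoss D h - expectedLoss D f|
      ≤ (1 + 1 / ε) / 2 * ∫ z, (h z.1 - f z.1) ^ 2 ∂D + ε / 2 * ∫ z, (f z.1 - z.2) ^ 2 ∂D := by
  have i1 : Integrable (sampleLoss f) D := hf.integrable_sq.const_mul (1 / 2)
  have i2 : Integrable (sampleLoss h) D := by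
    have := (hh.add hf).integrable_sq.const_mul (1 / 2)
    refine this.congr (ae_of_all _ fun z => ?_)
    simp [sampleLoss]
  have i3 := hh.integrable_sq.const_mul ((1 + 1 / ε) / 2)
  have i4 := hf.integrable_sq.const_mul (ε / 2)
  rw [expectedLoss, expectedLoss, ← integral_sub i2 i1, ← integral_const_mul,
    ← integral_const_mul, ← integral_add i3 i4, ← Real.norm_eq_abs]
  refine norm_integral_le_of_norm_le (i3.add i4) (ae_of_all _ fun z => ?_)
  rw [Real.norm_eq_abs]
  simp only [sampleLoss]
  set a := h z.1 - f z.1 with ha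
  set c := f z.1 - z.2 with hc
  have h1 : 1 / 2 * (h z.1 - z.2) ^ 2 - 1 / 2 * c ^ 2 = a ^ 2 / 2 + a * c := by
    rw [ha, hc]; ring
  have h2 : (1 + 1 / ε) / 2 * a ^ 2 + ε / 2 * c ^ 2 - a ^ 2 / 2
      = (a ^ 2 + ε ^ 2 * c ^ 2) / (2 * ε) := by field_simp; ring
  have h3 : |a * c| ≤ (a ^ 2 + ε ^ 2 * c ^ 2) / (2 * ε) := by
    rw [le_div_iff₀ (by positivity), abs_mul]
    nlinarith [sq_nonneg (|a| - ε * |c|), sq_abs a, sq_abs c]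
  have h4 : 0 ≤ a ^ 2 / 2 := by positivity
  rw [h1]
  refine (abs_add_le _ _).trans ?_
  rw [abs_of_nonneg h4]
  linarith

end Data

/-! ### Training on a noise-free target that is realizable at infinite width -/

/-- The samples of `D` lie over `X` and are labelled by the infinite-width network with weight
function `ν`; features and weights are almost surely bounded by `C` and `M`. -/
structure IsBoundedRealizable {d : ℕ} (X : Set (EuclideanSpace ℝ (Fin d))) (σ : ℝ → ℝ)
    (𝓤 : Measure (EuclideanSpace ℝ (Fin d))) (D : Measure (EuclideanSpace ℝ (Fin d) × ℝ))
    (ν : EuclideanSpace ℝ (Fin d) → ℝ) (C M : ℝ) : Prop where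
  isProbabilityMeasure : IsProbabilityMeasure D
  measurableSet : MeasurableSet X
  measurable_activation : Measurable σ
  measurable_weight : Measurable ν
  feature_bound_nonneg : 0 ≤ C
  weight_bound_nonneg : 0 ≤ M
  ae_feature_le : ∀ᵐ u ∂𝓤, ∀ x ∈ X, |σ (inner ℝ u x)| ≤ C
  ae_weight_le : ∀ᵐ u ∂𝓤, |ν u| ≤ M
  ae_label : ∀ᵐ z ∂D, z.1 ∈ X ∧ z.2 = infiniteNetwork σ 𝓤 ν z.1

section Training

variable {d m : ℕ} {X : Set (EuclideanSpace ℝ (Fin d))} {σ : ℝ → ℝ}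
  {𝓤 : Measure (EuclideanSpace ℝ (Fin d))} [IsProbabilityMeasure 𝓤]
  {D Dval : Measure (EuclideanSpace ℝ (Fin d) × ℝ)}
  {ν : EuclideanSpace ℝ (Fin d) → ℝ} {C M : ℝ}

/-- First-layer weights at which the features and the weight function obey their bounds. -/
def IsBoundedDraw (X : Set (EuclideanSpace ℝ (Fin d))) (σ : ℝ → ℝ)
    (ν : EuclideanSpace ℝ (Fin d) → ℝ) (C M : ℝ) (U : Fin m → EuclideanSpace ℝ (Fin d)) : Prop :=
  ∀ i, (∀ x ∈ X, |σ (inner ℝ (U i) x)| ≤ C) ∧ |ν (U i)| ≤ M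

/-- Samples over `X` with labels bounded by `Y`. -/
def boundedSamples (X : Set (EuclideanSpace ℝ (Fin d))) (Y : ℝ) :
    Set (EuclideanSpace ℝ (Fin d) × ℝ) :=
  {z | z.1 ∈ X ∧ |z.2| ≤ Y}

/-- The mean square error of the network with the sampled weights `ν(u_i)`. -/
noncomputable def samplingError (σ : ℝ → ℝ) (ν : EuclideanSpace ℝ (Fin d) → ℝ)
    (D : Measure (EuclideanSpace ℝ (Fin d) × ℝ)) (U : Fin m → EuclideanSpace ℝ (Fin d)) : ℝ :=
  ∫ z, residual (scaledFeature σ U) Prod.snd (sampledWeights ν U) z ^ 2 ∂D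

/-- The mean square error of a trained network under its training distribution. -/
noncomputable def trainedError (σ : ℝ → ℝ) (D : Measure (EuclideanSpace ℝ (Fin d) × ℝ)) (η : ℝ)
    {B : ℕ} (T : ℕ) (U : Fin m → EuclideanSpace ℝ (Fin d))
    (ω : ℕ → Fin B → EuclideanSpace ℝ (Fin d) × ℝ) : ℝ :=
  ∫ z, residual (scaledFeature σ U) Prod.snd (sgdIterate σ U η ω T) z ^ 2 ∂D

theorem measurable_trainedError (hσ : Measurable σ)
    (D : Measure (EuclideanSpace ℝ (Fin d) × ℝ)) [SFinite D] (η : ℝ) {B : ℕ} (T : ℕ)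
    {Ω : Type*} [MeasurableSpace Ω] {U : Ω → Fin m → EuclideanSpace ℝ (Fin d)}
    (hU : Measurable U) {s : Ω → ℕ → Fin B → EuclideanSpace ℝ (Fin d) × ℝ} (hs : Measurable s) :
    Measurable fun a => trainedError σ D η T (U a) (s a) := by
  have h1 : Measurable fun q : Ω × (EuclideanSpace ℝ (Fin d) × ℝ) =>
      sgdIterate σ (U q.1) η (s q.1) T :=
    measurable_sgdIterate hσ (hU.comp measurable_fst) η (hs.comp measurable_fst) T
  have h2 : Measurable fun q : Ω × (EuclideanSpace ℝ (Fin d) × ℝ) => scaledFeature σ (U q.1) q.2 :=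
    measurable_scaledFeature hσ (hU.comp measurable_fst) measurable_snd
  have h3 : Measurable fun q : Ω × (EuclideanSpace ℝ (Fin d) × ℝ) =>
      residual (scaledFeature σ (U q.1)) Prod.snd (sgdIterate σ (U q.1) η (s q.1) T) q.2 ^ 2 :=
    ((h1.inner h2).sub measurable_snd.snd).pow_const 2
  exact (h3.stronglyMeasurable.integral_prod_right' (ν := D)).measurable

theorem measurable_expectedLoss_network (hσ : Measurable σ)
    (Dval : Measure (EuclideanSpace ℝ (Fin d) × ℝ)) [SFinite Dval]
    {Ω : Type*} [MeasurableSpace Ω] {U : Ω → Fin m → EuclideanSpace ℝ (Fin d)}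
    (hU : Measurable U) {θ : Ω → EuclideanSpace ℝ (Fin m)} (hθ : Measurable θ) :
    Measurable fun a => expectedLoss Dval (network σ (U a) (θ a)) := by
  have h1 : Measurable fun q : Ω × (EuclideanSpace ℝ (Fin d) × ℝ) =>
      network σ (U q.1) (θ q.1) q.2.1 :=
    measurable_network hσ (hU.comp measurable_fst) (hθ.comp measurable_fst) measurable_snd.fst
  have h2 : Measurable fun q : Ω × (EuclideanSpace ℝ (Fin d) × ℝ) =>
      sampleLoss (network σ (U q.1) (θ q.1)) q.2 :=
    ((h1.sub measurable_snd.snd).pow_const 2).const_mul (1 / 2)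
  exact (h2.stronglyMeasurable.integral_prod_right' (ν := Dval)).measurable

namespace IsBoundedRealizable

theorem ae_isBoundedDraw (h : IsBoundedRealizable X σ 𝓤 D ν C M) (m : ℕ) :
    ∀ᵐ U ∂(Measure.pi fun _ : Fin m => 𝓤), IsBoundedDraw X σ ν C M U := by
  unfold IsBoundedDraw
  rw [ae_all_iff]
  exact fun i => (measurePreserving_eval (fun _ : Fin m => 𝓤) i).quasiMeasurePreserving.ae
    (h.ae_feature_le.and h.ae_weight_le)

theorem memLp_feature_mul_weight (h : IsBoundedRealizable X σ 𝓤 D ν C M)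
    {x : EuclideanSpace ℝ (Fin d)} (hx : x ∈ X) : MemLp (fun u => σ (inner ℝ u x) * ν u) 2 𝓤 := by
  have h1 := h.measurable_activation
  have h2 := h.measurable_weight
  refine MemLp.of_bound (by fun_prop) (C * M) ?_
  filter_upwards [h.ae_feature_le, h.ae_weight_le] with u hu hu'
  rw [Real.norm_eq_abs, abs_mul]
  exact mul_le_mul (hu x hx) hu' (abs_nonneg _) h.feature_bound_nonneg

theorem abs_infiniteNetwork_le (h : IsBoundedRealizable X σ 𝓤 D ν C M)
    {x : EuclideanSpace ℝ (Fin d)} (hx : x ∈ X) : |infiniteNetwork σ 𝓤 ν x| ≤ C * M := by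
  have := norm_integral_le_of_norm_le_const (μ := 𝓤) (f := fun u => σ (inner ℝ u x) * ν u)
    (C := C * M) (by
      filter_upwards [h.ae_feature_le, h.ae_weight_le] with u hu hu'
      rw [Real.norm_eq_abs, abs_mul]
      exact mul_le_mul (hu x hx) hu' (abs_nonneg _) h.feature_bound_nonneg)
  simpa [infiniteNetwork] using this

theorem ae_mem_boundedSamples (h : IsBoundedRealizable X σ 𝓤 D ν C M) :
    ∀ᵐ z ∂D, z ∈ boundedSamples X (C * M) := by
  filter_upwards [h.ae_label] with z hz
  exact ⟨hz.1, by rw [hz.2]; exact h.abs_infiniteNetwork_le hz.1⟩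

theorem measurableSet_boundedSamples (h : IsBoundedRealizable X σ 𝓤 D ν C M) (Y : ℝ) :
    MeasurableSet (boundedSamples X Y) :=
  (measurable_fst h.measurableSet).inter
    (measurableSet_le (measurable_snd.abs) measurable_const)

/-- The bounds on features and labels hold only for almost every sample. Truncation makes them hold
everywhere and changes neither the iterates nor the residuals on almost every stream and sample. -/
theorem isBoundedRegression (h : IsBoundedRealizable X σ 𝓤 D ν C M) (hm : 1 ≤ m)
    {U : Fin m → EuclideanSpace ℝ (Fin d)} (hU : IsBoundedDraw X σ ν C M U) :
    IsBoundedRegression ((boundedSamples X (C * M)).indicator (scaledFeature σ U))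
      ((boundedSamples X (C * M)).indicator Prod.snd) C (C * M) where
  measurable_feature := (measurable_scaledFeature h.measurable_activation measurable_const
    measurable_id).indicator (h.measurableSet_boundedSamples _)
  norm_feature_le z := by
    by_cases hz : z ∈ boundedSamples X (C * M)
    · rw [Set.indicator_of_mem hz]
      exact norm_scaledFeature_le hm fun i => (hU i).1 z.1 hz.1
    · rw [Set.indicator_of_notMem hz, norm_zero]; exact h.feature_bound_nonneg
  measurable_label := measurable_snd.indicator (h.measurableSet_boundedSamples _)
  abs_label_le z := by
    by_cases hz : z ∈ boundedSamples X (C * M)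
    · rw [Set.indicator_of_mem hz]; exact hz.2
    · rw [Set.indicator_of_notMem hz, abs_zero]
      exact mul_nonneg h.feature_bound_nonneg h.weight_bound_nonneg

theorem sgdIterate_eq_truncated {U : Fin m → EuclideanSpace ℝ (Fin d)} {B : ℕ}
    {ω : ℕ → Fin B → EuclideanSpace ℝ (Fin d) × ℝ} {Y : ℝ}
    (hω : ∀ t b, ω t b ∈ boundedSamples X Y) (η : ℝ) (t : ℕ) :
    sgdIterate σ U η ω t = lmsIterate ((boundedSamples X Y).indicator (scaledFeature σ U))
      ((boundedSamples X Y).indicator Prod.snd) η ω t := by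
  rw [sgdIterate_eq_lmsIterate]
  exact lmsIterate_congr (fun t b => (Set.indicator_of_mem (hω t b) _).symm)
    (fun t b => (Set.indicator_of_mem (hω t b) _).symm) η t

theorem residual_truncated {U : Fin m → EuclideanSpace ℝ (Fin d)} {Y : ℝ}
    {z : EuclideanSpace ℝ (Fin d) × ℝ} (hz : z ∈ boundedSamples X Y)
    (θ : EuclideanSpace ℝ (Fin m)) :
    residual ((boundedSamples X Y).indicator (scaledFeature σ U))
      ((boundedSamples X Y).indicator Prod.snd) θ z
      = residual (scaledFeature σ U) Prod.snd θ z := by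
  simp only [residual, Set.indicator_of_mem hz]

theorem norm_sgdIterate_le (h : IsBoundedRealizable X σ 𝓤 D ν C M) (hm : 1 ≤ m)
    {U : Fin m → EuclideanSpace ℝ (Fin d)} (hU : IsBoundedDraw X σ ν C M U) {B : ℕ} (hB : 1 ≤ B)
    {ω : ℕ → Fin B → EuclideanSpace ℝ (Fin d) × ℝ}
    (hω : ∀ t b, ω t b ∈ boundedSamples X (C * M)) (η : ℝ) (t : ℕ) :
    ‖sgdIterate σ U η ω t‖ ≤ iterateBound C (C * M) η t := by
  rw [sgdIterate_eq_truncated hω]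
  exact (h.isBoundedRegression hm hU).norm_lmsIterate_le η hB ω t

/-- The mean error of training for a fixed draw of the first layer. -/
theorem integral_trainedError_le (h : IsBoundedRealizable X σ 𝓤 D ν C M) (hm : 1 ≤ m)
    {U : Fin m → EuclideanSpace ℝ (Fin d)} (hU : IsBoundedDraw X σ ν C M U) {η : ℝ}
    (hη : 0 < η) (hηC : η * C ^ 2 ≤ 1 / 4) {B : ℕ} (hB : 1 ≤ B) {T : ℕ} (hT : 0 < T) :
    ∫ ω, trainedError σ D η T U ω ∂(streamLaw D B)
      ≤ 4 * M ^ 2 / (η * T) + 4 * samplingError σ ν D U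
        + 24 * (η * C ^ 2) * (C ^ 2 * M ^ 2 + (m + 1) * samplingError σ ν D U) := by
  have := h.isProbabilityMeasure
  have hR := h.isBoundedRegression hm hU
  set ψ := (boundedSamples X (C * M)).indicator (scaledFeature σ U) with hψ
  set y : EuclideanSpace ℝ (Fin d) × ℝ → ℝ := (boundedSamples X (C * M)).indicator Prod.snd with hy
  have hres : ∀ θ, ∫ z, residual ψ y θ z ^ 2 ∂D
      = ∫ z, residual (scaledFeature σ U) Prod.snd θ z ^ 2 ∂D := fun θ => by
    refine integral_congr_ae ?_
    filter_upwards [h.ae_mem_boundedSamples] with z hz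
    rw [hψ, hy, residual_truncated hz]
  have h1 : ∫ ω, trainedError σ D η T U ω ∂(streamLaw D B)
      = ∫ z, meanSqResidual D ψ y η B T z ∂D := by
    have h2 := hR.integral_sq_residual_eq (D := D) η hB T (g := fun _ => 1) measurable_const
      (K := 1) (fun _ => by simp)
    simp only [mul_one] at h2
    rw [← h2]
    refine integral_congr_ae ?_
    filter_upwards [ae_streamLaw h.ae_mem_boundedSamples B] with ω hω
    rw [trainedError, hres, sgdIterate_eq_truncated hω]
  have h2 := hR.integral_meanSqResidual_le_of_comparator (D := D) hη hηC hB hT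
    (sampledWeights ν U)
  rw [hres, finrank_euclideanSpace, Fintype.card_fin] at h2
  have h3 := norm_sq_sampledWeights_le hm fun i => (hU i).2
  rw [h1]
  refine h2.trans ?_
  unfold samplingError
  gcongr

theorem ae_prod_samplingError (h : IsBoundedRealizable X σ 𝓤 D ν C M) (hm : 1 ≤ m) :
    ∀ᵐ p ∂((Measure.pi fun _ : Fin m => 𝓤).prod D),
      |residual (scaledFeature σ p.1) Prod.snd (sampledWeights ν p.1) p.2| ≤ M * C + C * M := by
  have := h.isProbabilityMeasure
  filter_upwards [Measure.quasiMeasurePreserving_fst.ae (h.ae_isBoundedDraw m),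
    Measure.quasiMeasurePreserving_snd.ae h.ae_mem_boundedSamples] with p hU hz
  rw [← residual_truncated hz]
  refine (h.isBoundedRegression hm hU).abs_residual_le ?_ p.2
  exact (sq_le_sq₀ (norm_nonneg _) h.weight_bound_nonneg).1
    (norm_sq_sampledWeights_le hm fun i => (hU i).2)

theorem integrable_sq_samplingError (h : IsBoundedRealizable X σ 𝓤 D ν C M) (hm : 1 ≤ m) :
    Integrable (fun p : (Fin m → EuclideanSpace ℝ (Fin d)) × (EuclideanSpace ℝ (Fin d) × ℝ) =>
      residual (scaledFeature σ p.1) Prod.snd (sampledWeights ν p.1) p.2 ^ 2)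
      ((Measure.pi fun _ : Fin m => 𝓤).prod D) := by
  have := h.isProbabilityMeasure
  have hσ := h.measurable_activation
  have hν := h.measurable_weight
  have h1 : Measurable fun p : (Fin m → EuclideanSpace ℝ (Fin d)) ×
      (EuclideanSpace ℝ (Fin d) × ℝ) =>
      residual (scaledFeature σ p.1) Prod.snd (sampledWeights ν p.1) p.2 := by
    simp only [residual, inner_sampledWeights, sampleMean]
    fun_prop
  refine Integrable.of_bound (h1.pow_const 2).aestronglyMeasurable ((M * C + C * M) ^ 2) ?_
  filter_upwards [h.ae_prod_samplingError hm] with p hp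
  rw [Real.norm_eq_abs, abs_pow]
  exact pow_le_pow_left₀ (abs_nonneg _) hp 2

theorem integrable_samplingError (h : IsBoundedRealizable X σ 𝓤 D ν C M) (hm : 1 ≤ m) :
    Integrable (samplingError σ ν D) (Measure.pi fun _ : Fin m => 𝓤) := by
  have := h.isProbabilityMeasure
  exact (h.integrable_sq_samplingError hm).integral_prod_left

/-- After exchanging the integrals, the inner one is the variance of a mean of m independent terms
bounded by CM, because the label at z is exactly their expectation. -/
theorem integral_samplingError_le (h : IsBoundedRealizable X σ 𝓤 D ν C M) (hm : 1 ≤ m) :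
    ∫ U, samplingError σ ν D U ∂(Measure.pi fun _ : Fin m => 𝓤) ≤ (C * M) ^ 2 / m := by
  have := h.isProbabilityMeasure
  have hi := h.integrable_sq_samplingError hm
  unfold samplingError
  rw [integral_integral_swap hi]
  have h1 : ∀ᵐ z ∂D, ∫ U, residual (scaledFeature σ U) Prod.snd (sampledWeights ν U) z ^ 2
      ∂(Measure.pi fun _ : Fin m => 𝓤) ≤ (C * M) ^ 2 / m := by
    filter_upwards [h.ae_label] with z hz
    have hg := h.memLp_feature_mul_weight hz.1
    have h2 := variance_sampleMean hm hg
    simp only [residual, inner_sampledWeights]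
    rw [hz.2]
    refine h2.trans ?_
    rw [div_mul_eq_mul_div, one_mul]
    refine div_le_div_of_nonneg_right ?_ (Nat.cast_nonneg m)
    have h3 := integral_mono_ae hg.integrable_sq (integrable_const ((C * M) ^ 2)) (by
      filter_upwards [h.ae_feature_le, h.ae_weight_le] with u hu hu'
      rw [← sq_abs, abs_mul]
      exact pow_le_pow_left₀ (by positivity)
        (mul_le_mul (hu z.1 hz.1) hu' (abs_nonneg _) h.feature_bound_nonneg) 2)
    simpa using h3
  have h2 := integral_mono_ae hi.integral_prod_right (integrable_const _) h1
  simpa using h2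

theorem ae_bounded_training (h : IsBoundedRealizable X σ 𝓤 D ν C M) (m B : ℕ) :
    ∀ᵐ p ∂((Measure.pi fun _ : Fin m => 𝓤).prod (streamLaw D B)),
      IsBoundedDraw X σ ν C M p.1 ∧ ∀ t b, p.2 t b ∈ boundedSamples X (C * M) := by
  have := h.isProbabilityMeasure
  exact (Measure.quasiMeasurePreserving_fst.ae (h.ae_isBoundedDraw m)).and
    (Measure.quasiMeasurePreserving_snd.ae (ae_streamLaw h.ae_mem_boundedSamples B))

theorem abs_network_sub_le (h : IsBoundedRealizable X σ 𝓤 D ν C M) (hm : 1 ≤ m)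
    {U : Fin m → EuclideanSpace ℝ (Fin d)} (hU : IsBoundedDraw X σ ν C M U)
    {θ : EuclideanSpace ℝ (Fin m)} {K : ℝ} (hθ : ‖θ‖ ≤ K) {x : EuclideanSpace ℝ (Fin d)}
    (hx : x ∈ X) : |network σ U θ x - infiniteNetwork σ 𝓤 ν x| ≤ K * C + C * M := by
  have hz : (x, infiniteNetwork σ 𝓤 ν x) ∈ boundedSamples X (C * M) :=
    ⟨hx, h.abs_infiniteNetwork_le hx⟩
  have h1 := (h.isBoundedRegression hm hU).abs_residual_le hθ (x, infiniteNetwork σ 𝓤 ν x)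
  rw [residual_truncated hz, residual, ← network_eq_inner] at h1
  exact h1

theorem measurable_network_sub (h : IsBoundedRealizable X σ 𝓤 D ν C M)
    (U : Fin m → EuclideanSpace ℝ (Fin d)) (θ : EuclideanSpace ℝ (Fin m)) :
    Measurable fun x => network σ U θ x - infiniteNetwork σ 𝓤 ν x :=
  (measurable_network h.measurable_activation measurable_const measurable_const measurable_id).sub
    (measurable_infiniteNetwork h.measurable_activation h.measurable_weight 𝓤)

theorem memLp_network_sub (h : IsBoundedRealizable X σ 𝓤 D ν C M) [IsFiniteMeasure Dval]
    (hval : ∀ᵐ z ∂Dval, z.1 ∈ X) (hm : 1 ≤ m)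
    {U : Fin m → EuclideanSpace ℝ (Fin d)} (hU : IsBoundedDraw X σ ν C M U)
    (θ : EuclideanSpace ℝ (Fin m)) :
    MemLp (fun z : EuclideanSpace ℝ (Fin d) × ℝ =>
      network σ U θ z.1 - infiniteNetwork σ 𝓤 ν z.1) 2 Dval := by
  refine MemLp.of_bound ((h.measurable_network_sub U θ).comp measurable_fst).aestronglyMeasurable
    (‖θ‖ * C + C * M) ?_
  filter_upwards [hval] with z hz
  exact h.abs_network_sub_le hm hU le_rfl hz

/-- The error under the validation distribution is controlled by the training error. -/
theorem integral_sq_network_sub_le (h : IsBoundedRealizable X σ 𝓤 D ν C M)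
    {κ : ℝ≥0} (hκ : inputMarginal Dval ≤ (κ : ℝ≥0∞) • inputMarginal D) (hm : 1 ≤ m)
    {U : Fin m → EuclideanSpace ℝ (Fin d)} (hU : IsBoundedDraw X σ ν C M U)
    (θ : EuclideanSpace ℝ (Fin m)) :
    ∫ z, (network σ U θ z.1 - infiniteNetwork σ 𝓤 ν z.1) ^ 2 ∂Dval
      ≤ κ * ∫ z, residual (scaledFeature σ U) Prod.snd θ z ^ 2 ∂D := by
  have := h.isProbabilityMeasure
  have hmeas := (h.measurable_network_sub U θ).pow_const 2
  have hX : ∀ᵐ z ∂D, z.1 ∈ X := h.ae_label.mono fun z hz => hz.1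
  -- The integrand depends on the input only, so both sides can be compared through the input
  -- marginals, where the domination holds.
  have h1 : ∀ D' : Measure (EuclideanSpace ℝ (Fin d) × ℝ),
      ∫ z, (network σ U θ z.1 - infiniteNetwork σ 𝓤 ν z.1) ^ 2 ∂D'
        = ∫ x, (network σ U θ x - infiniteNetwork σ 𝓤 ν x) ^ 2 ∂(inputMarginal D') := fun D' =>
    (integral_map measurable_fst.aemeasurable hmeas.aestronglyMeasurable).symm
  have hi : Integrable (fun x => (network σ U θ x - infiniteNetwork σ 𝓤 ν x) ^ 2)
      (inputMarginal D) :=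
    (integrable_map_measure hmeas.aestronglyMeasurable measurable_fst.aemeasurable).2
      (h.memLp_network_sub hX hm hU θ).integrable_sq
  have h2 := integral_mono_measure hκ (ae_of_all _ fun x => sq_nonneg
    (network σ U θ x - infiniteNetwork σ 𝓤 ν x)) (hi.smul_measure ENNReal.coe_ne_top)
  rw [integral_smul_measure, ← h1, ← h1] at h2
  refine h2.trans_eq ?_
  simp only [ENNReal.coe_toReal, smul_eq_mul]
  congr 1
  refine integral_congr_ae ?_
  filter_upwards [h.ae_label] with z hz
  rw [residual, ← network_eq_inner, hz.2]

theorem integrable_trainedError (h : IsBoundedRealizable X σ 𝓤 D ν C M) (hm : 1 ≤ m) (η : ℝ)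
    {B : ℕ} (hB : 1 ≤ B) (T : ℕ) :
    Integrable (fun p : (Fin m → EuclideanSpace ℝ (Fin d)) ×
      (ℕ → Fin B → EuclideanSpace ℝ (Fin d) × ℝ) => trainedError σ D η T p.1 p.2)
      ((Measure.pi fun _ : Fin m => 𝓤).prod (streamLaw D B)) := by
  have := h.isProbabilityMeasure
  have h1 := measurable_trainedError h.measurable_activation D η T
    (measurable_fst (α := Fin m → EuclideanSpace ℝ (Fin d))
      (β := ℕ → Fin B → EuclideanSpace ℝ (Fin d) × ℝ)) measurable_snd
  refine Integrable.of_bound h1.aestronglyMeasurable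
    ((iterateBound C (C * M) η T * C + C * M) ^ 2) ?_
  filter_upwards [h.ae_bounded_training m B] with p hp
  have h2 := norm_integral_le_of_norm_le_const (μ := D)
    (f := fun z => residual (scaledFeature σ p.1) Prod.snd (sgdIterate σ p.1 η p.2 T) z ^ 2)
    (C := (iterateBound C (C * M) η T * C + C * M) ^ 2) (by
      filter_upwards [h.ae_mem_boundedSamples] with z hz
      rw [← residual_truncated hz, Real.norm_eq_abs, abs_of_nonneg (sq_nonneg _)]
      exact (h.isBoundedRegression hm hp.1).sq_residual_le
        (h.norm_sgdIterate_le hm hp.1 hB hp.2 η T) z)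
  simpa [trainedError] using h2

/-- The average over the first layer is where the dimension factor m + 1 of the leverage bound meets
a sampling error of mean O(1/m). Their product is at most 2(CM)², so the noise term is O(η)
uniformly in m. -/
theorem integral_prod_trainedError_le (h : IsBoundedRealizable X σ 𝓤 D ν C M) (hm : 1 ≤ m)
    {η : ℝ} (hη : 0 < η) (hηC : η * C ^ 2 ≤ 1 / 4) {B : ℕ} (hB : 1 ≤ B) {T : ℕ} (hT : 0 < T) :
    ∫ p, trainedError σ D η T p.1 p.2 ∂((Measure.pi fun _ : Fin m => 𝓤).prod (streamLaw D B))
      ≤ 4 * M ^ 2 / (η * T) + 4 * ((C * M) ^ 2 / m) + 72 * (η * C ^ 2) * (C * M) ^ 2 := by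
  have := h.isProbabilityMeasure
  have hi := h.integrable_trainedError hm η hB T
  have hs := h.integrable_samplingError hm
  have hm' : (1 : ℝ) ≤ m := by exact_mod_cast hm
  rw [integral_prod _ hi]
  have i0 := (integrable_const (μ := Measure.pi fun _ : Fin m => 𝓤) (4 * M ^ 2 / (η * T)))
  have i1 := i0.add (hs.const_mul 4)
  have i2 := ((integrable_const (μ := Measure.pi fun _ : Fin m => 𝓤) (C ^ 2 * M ^ 2)).add
    (hs.const_mul ((m : ℝ) + 1))).const_mul (24 * (η * C ^ 2))
  have h1 := integral_mono_ae hi.integral_prod_left (i1.add i2) (by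
    filter_upwards [h.ae_isBoundedDraw m] with U hU
    exact h.integral_trainedError_le hm hU hη hηC hB hT)
  refine h1.trans ?_
  have h2 := h.integral_samplingError_le hm
  rw [integral_add' i1 i2, integral_add' i0 (hs.const_mul 4)]
  simp only [Pi.add_apply]
  rw [integral_const_mul, integral_const_mul,
    integral_add (integrable_const _) (hs.const_mul ((m : ℝ) + 1)),
    integral_const_mul ((m : ℝ) + 1)]
  simp only [integral_const, probReal_univ, smul_eq_mul, one_mul]
  set S := ∫ U, samplingError σ ν D U ∂(Measure.pi fun _ : Fin m => 𝓤)
  have h3 : ((m : ℝ) + 1) * S ≤ 2 * (C * M) ^ 2 := by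
    calc ((m : ℝ) + 1) * S ≤ (m + 1) * ((C * M) ^ 2 / m) := by gcongr
      _ = (C * M) ^ 2 * ((m + 1) / m) := by ring
      _ ≤ (C * M) ^ 2 * 2 := by
          gcongr
          rw [div_le_iff₀ (by linarith)]; linarith
      _ = _ := by ring
  have h4 : 24 * (η * C ^ 2) * (C ^ 2 * M ^ 2 + (m + 1) * S)
      ≤ 24 * (η * C ^ 2) * (C ^ 2 * M ^ 2 + 2 * (C * M) ^ 2) := by gcongr
  nlinarith

/-- The expected validation loss of a trained network is close to that of the target. -/
theorem abs_expectedTrainedLoss_sub_le (h : IsBoundedRealizable X σ 𝓤 D ν C M)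
    [IsProbabilityMeasure Dval] (hval : ∀ᵐ z ∂Dval, z.1 ∈ X)
    (hsq : MemLp (fun z : EuclideanSpace ℝ (Fin d) × ℝ => infiniteNetwork σ 𝓤 ν z.1 - z.2) 2 Dval)
    {κ : ℝ≥0} (hκ : inputMarginal Dval ≤ (κ : ℝ≥0∞) • inputMarginal D) (hm : 1 ≤ m)
    {η : ℝ} (hη : 0 < η) (hηC : η * C ^ 2 ≤ 1 / 4) {B : ℕ} (hB : 1 ≤ B) {T : ℕ} (hT : 0 < T)
    {ε : ℝ} (hε : 0 < ε) :
    |expectedTrainedLoss σ 𝓤 Dval D m η B T - expectedLoss Dval (infiniteNetwork σ 𝓤 ν)|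
      ≤ (1 + 1 / ε) / 2 * (κ * (4 * M ^ 2 / (η * T) + 4 * ((C * M) ^ 2 / m)
          + 72 * (η * C ^ 2) * (C * M) ^ 2))
        + ε / 2 * ∫ z, (infiniteNetwork σ 𝓤 ν z.1 - z.2) ^ 2 ∂Dval := by
  have := h.isProbabilityMeasure
  have hσ := h.measurable_activation
  set f := infiniteNetwork σ 𝓤 ν with hf
  set c := ∫ z, (f z.1 - z.2) ^ 2 ∂Dval with hc
  set Q := (Measure.pi fun _ : Fin m => 𝓤).prod (streamLaw D B) with hQ
  have hloss := measurable_expectedLoss_network hσ Dval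
    (measurable_snd (α := EuclideanSpace ℝ (Fin m)) (β := Fin m → EuclideanSpace ℝ (Fin d)))
    measurable_fst
  have hθ : Measurable fun p : (Fin m → EuclideanSpace ℝ (Fin d)) ×
      (ℕ → Fin B → EuclideanSpace ℝ (Fin d) × ℝ) => sgdIterate σ p.1 η p.2 T :=
    measurable_sgdIterate (U := Prod.fst) (s := Prod.snd) hσ measurable_fst η measurable_snd T
  have hpair : Measurable fun p : (Fin m → EuclideanSpace ℝ (Fin d)) ×
      (ℕ → Fin B → EuclideanSpace ℝ (Fin d) × ℝ) => (sgdIterate σ p.1 η p.2 T, p.1) :=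
    hθ.prodMk measurable_fst
  set L : (Fin m → EuclideanSpace ℝ (Fin d)) ×
      (ℕ → Fin B → EuclideanSpace ℝ (Fin d) × ℝ) → ℝ :=
    fun p => expectedLoss Dval (network σ p.1 (sgdIterate σ p.1 η p.2 T)) with hL
  have hLm : Measurable L :=
    measurable_expectedLoss_network (U := Prod.fst) hσ Dval measurable_fst hθ
  have h1 : expectedTrainedLoss σ 𝓤 Dval D m η B T = ∫ p, L p ∂Q := by
    unfold expectedTrainedLoss trainedLaw
    rw [integral_map hpair.aemeasurable hloss.aestronglyMeasurable]
    rfl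
  have hi := h.integrable_trainedError hm η hB T
  have hbi : Integrable (fun p => (1 + 1 / ε) / 2 * (κ * trainedError σ D η T p.1 p.2)
      + ε / 2 * c) Q := ((hi.const_mul _).const_mul _).add (integrable_const _)
  have hle : ∀ᵐ p ∂Q, ‖L p - expectedLoss Dval f‖
      ≤ (1 + 1 / ε) / 2 * (κ * trainedError σ D η T p.1 p.2) + ε / 2 * c := by
    filter_upwards [h.ae_bounded_training m B] with p hp
    have h2 := h.integral_sq_network_sub_le hκ hm hp.1 (sgdIterate σ p.1 η p.2 T)
    have h3 := abs_expectedLoss_sub_le (f := f) (h := network σ p.1 (sgdIterate σ p.1 η p.2 T)) hsq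
      (h.memLp_network_sub hval hm hp.1 (sgdIterate σ p.1 η p.2 T)) hε
    have h4 : (0 : ℝ) ≤ (1 + 1 / ε) / 2 := by positivity
    exact h3.trans (add_le_add (mul_le_mul_of_nonneg_left h2 h4) le_rfl)
  have hdi : Integrable (fun p => L p - expectedLoss Dval f) Q :=
    hbi.mono' (hLm.sub_const _).aestronglyMeasurable hle
  -- Integrability of the loss comes from its dominated difference to a constant, not from a direct
  -- bound.
  have hLi : Integrable L Q := by
    refine (hdi.add (integrable_const (expectedLoss Dval f))).congr (ae_of_all _ fun p => ?_)
    simp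
  have h2 : expectedTrainedLoss σ 𝓤 Dval D m η B T - expectedLoss Dval f
      = ∫ p, (L p - expectedLoss Dval f) ∂Q := by
    rw [h1, integral_sub hLi (integrable_const _)]; simp
  rw [h2, ← Real.norm_eq_abs]
  refine (norm_integral_le_of_norm_le hbi hle).trans ?_
  rw [integral_add ((hi.const_mul _).const_mul _) (integrable_const _), integral_const_mul,
    integral_const_mul]
  simp only [integral_const, probReal_univ, smul_eq_mul, one_mul]
  have h3 := h.integral_prod_trainedError_le hm hη hηC hB hT
  gcongr

/-- For wide networks, many steps and small learning rates the expected validation loss of a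
trained network is within `ε` of that of the target. -/
theorem exists_abs_expectedTrainedLoss_sub_lt (h : IsBoundedRealizable X σ 𝓤 D ν C M)
    [IsProbabilityMeasure Dval] (hval : ∀ᵐ z ∂Dval, z.1 ∈ X)
    (hsq : MemLp (fun z : EuclideanSpace ℝ (Fin d) × ℝ => infiniteNetwork σ 𝓤 ν z.1 - z.2) 2 Dval)
    {κ : ℝ≥0} (hκ : inputMarginal Dval ≤ (κ : ℝ≥0∞) • inputMarginal D) {ε : ℝ} (hε : 0 < ε) :
    ∃ δ : ℝ, 0 < δ ∧ ∀ m T B : ℕ, 1 ≤ B → 0 < T → 1 ≤ m → 1 / (m : ℝ) ≤ δ → ∀ η : ℝ, 0 < η →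
      η ≤ δ → 1 / (η * T) ≤ δ →
        |expectedTrainedLoss σ 𝓤 Dval D m η B T - expectedLoss Dval (infiniteNetwork σ 𝓤 ν)|
          < ε := by
  set c := ∫ z, (infiniteNetwork σ 𝓤 ν z.1 - z.2) ^ 2 ∂Dval with hc
  have hc0 : 0 ≤ c := integral_nonneg fun _ => sq_nonneg _
  -- Chosen so that ε' c / 2 ≤ ε / 2; the summand 1 covers c = 0.
  set ε' := ε / (c + 1) with hε'
  have hε'0 : 0 < ε' := by positivity
  set N := (1 + 1 / ε') / 2 * (κ * (4 * M ^ 2 + 4 * (C * M) ^ 2 + 72 * C ^ 2 * (C * M) ^ 2))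
    with hN
  have hN0 : 0 ≤ N := by positivity
  -- The first entry makes N δ < ε / 2, where N collects the coefficients of 1/(ηT), 1/m and η. The
  -- second guarantees ηC² ≤ 1/4, as the noise absorption requires.
  refine ⟨min (ε / (2 * (N + 1))) (1 / (4 * (C ^ 2 + 1))), by positivity, ?_⟩
  intro m T B hB hT hm hmδ η hη hηδ hTδ
  set δ := min (ε / (2 * (N + 1))) (1 / (4 * (C ^ 2 + 1))) with hδ
  have hηC : η * C ^ 2 ≤ 1 / 4 := by
    calc η * C ^ 2 ≤ 1 / (4 * (C ^ 2 + 1)) * C ^ 2 := by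
          gcongr; exact hηδ.trans (min_le_right _ _)
      _ ≤ 1 / (4 * (C ^ 2 + 1)) * (C ^ 2 + 1) := by gcongr; linarith
      _ = 1 / 4 := by field_simp
  refine (h.abs_expectedTrainedLoss_sub_le hval hsq hκ hm hη hηC hB hT hε'0).trans_lt ?_
  have h1 : 4 * M ^ 2 / (η * T) + 4 * ((C * M) ^ 2 / m) + 72 * (η * C ^ 2) * (C * M) ^ 2
      ≤ (4 * M ^ 2 + 4 * (C * M) ^ 2 + 72 * C ^ 2 * (C * M) ^ 2) * δ := by
    calc _ = 4 * M ^ 2 * (1 / (η * T)) + 4 * (C * M) ^ 2 * (1 / m)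
          + 72 * C ^ 2 * (C * M) ^ 2 * η := by ring
      _ ≤ 4 * M ^ 2 * δ + 4 * (C * M) ^ 2 * δ + 72 * C ^ 2 * (C * M) ^ 2 * δ := by gcongr
      _ = _ := by ring
  have h2 : (1 + 1 / ε') / 2 * (κ * (4 * M ^ 2 / (η * T) + 4 * ((C * M) ^ 2 / m)
      + 72 * (η * C ^ 2) * (C * M) ^ 2)) ≤ N * δ := by
    calc _ ≤ (1 + 1 / ε') / 2 * (κ * ((4 * M ^ 2 + 4 * (C * M) ^ 2
          + 72 * C ^ 2 * (C * M) ^ 2) * δ)) := by gcongr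
      _ = N * δ := by rw [hN]; ring
  have hδ0 : 0 < δ := by positivity
  have h3 : N * δ < ε / 2 := by
    calc N * δ < (N + 1) * δ := by linarith
      _ ≤ (N + 1) * (ε / (2 * (N + 1))) := by gcongr; exact min_le_left _ _
      _ = ε / 2 := by field_simp
  have h4 : ε' / 2 * c ≤ ε / 2 := by
    rw [hε', div_div, div_mul_eq_mul_div, div_le_div_iff₀ (by positivity) (by norm_num)]
    nlinarith
  linarith

end IsBoundedRealizable

end Training

/-! ### From well-behaved distributions to the comparison of signs -/

/-- The ingredients of a well-behaved distribution that training needs. -/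
theorem IsWellBehaved.exists_isBoundedRealizable {d : ℕ} {X : Set (EuclideanSpace ℝ (Fin d))}
    (hX : IsCompact X) {σ : ℝ → ℝ} {K : ℝ≥0} (hσ : LipschitzWith K σ)
    {𝓤 : Measure (EuclideanSpace ℝ (Fin d))} [IsProbabilityMeasure 𝓤] {r : ℝ}
    (h𝓤 : ∀ᵐ u ∂𝓤, ‖u‖ ≤ r) {Dval D : Measure (EuclideanSpace ℝ (Fin d) × ℝ)}
    (hD : IsDataDistribution X D) {f : EuclideanSpace ℝ (Fin d) → ℝ}
    (hf : IsNoiseFreeTarget D f) (hw : IsWellBehaved X σ 𝓤 Dval D f) :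
    ∃ ν C M, IsBoundedRealizable X σ 𝓤 D ν C M ∧ ∀ x ∈ X, f x = infiniteNetwork σ 𝓤 ν x := by
  obtain ⟨ν, hν, ⟨M, hM⟩, hfν⟩ := hw.realizable
  obtain ⟨R, hR⟩ := hX.isBounded.exists_norm_le
  refine ⟨ν, |σ 0| + K * (|r| * |R|), |M|, ⟨hD.isProbabilityMeasure, hX.measurableSet,
    hσ.continuous.measurable, hν, by positivity, abs_nonneg M, ?_, ?_, ?_⟩, hfν⟩
  · filter_upwards [h𝓤] with u hu x hx
    have h1 := hσ.dist_le_mul (inner ℝ u x) 0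
    rw [Real.dist_eq, Real.dist_eq, sub_zero] at h1
    have h2 : |(inner ℝ u x : ℝ)| ≤ |r| * |R| := (abs_real_inner_le_norm u x).trans
      (mul_le_mul (hu.trans (le_abs_self r)) ((hR x hx).trans (le_abs_self R)) (norm_nonneg _)
        (abs_nonneg _))
    have h3 : |σ (inner ℝ u x)| ≤ |σ 0| + |σ (inner ℝ u x) - σ 0| := by
      have := abs_add_le (σ 0) (σ (inner ℝ u x) - σ 0)
      rwa [add_sub_cancel] at this
    have h4 : (K : ℝ) * |(inner ℝ u x : ℝ)| ≤ K * (|r| * |R|) :=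
      mul_le_mul_of_nonneg_left h2 K.coe_nonneg
    linarith
  · filter_upwards [Measure.support_mem_ae (μ := 𝓤)] with u hu
    exact (hM u hu).trans (le_abs_self M)
  · filter_upwards [hD.ae_mem hX.measurableSet, hf] with z hz hz'
    exact ⟨hz, hz'.trans (hfν z.1 hz)⟩

theorem expectedLoss_congr {d : ℕ} {X : Set (EuclideanSpace ℝ (Fin d))}
    {D : Measure (EuclideanSpace ℝ (Fin d) × ℝ)} (hD : ∀ᵐ z ∂D, z.1 ∈ X)
    {f g : EuclideanSpace ℝ (Fin d) → ℝ} (hfg : ∀ x ∈ X, f x = g x) :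
    expectedLoss D f = expectedLoss D g := by
  refine integral_congr_ae ?_
  filter_upwards [hD] with z hz
  rw [sampleLoss, sampleLoss, hfg z.1 hz]

/-- If some bounded predictor has nonzero expected loss, then the labels are square integrable,
because the expected loss would be zero by convention otherwise. -/
theorem memLp_snd_of_expectedLoss_ne_zero {d : ℕ} {D : Measure (EuclideanSpace ℝ (Fin d) × ℝ)}
    [IsFiniteMeasure D] {f : EuclideanSpace ℝ (Fin d) → ℝ} (hf : Measurable f) {K : ℝ}
    (hK : ∀ᵐ z ∂D, |f z.1| ≤ K) (h : expectedLoss D f ≠ 0) :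
    MemLp (Prod.snd : EuclideanSpace ℝ (Fin d) × ℝ → ℝ) 2 D := by
  have h1 : Integrable (sampleLoss f) D := by
    by_contra hni
    exact h (integral_undef hni)
  have hm : Measurable fun z : EuclideanSpace ℝ (Fin d) × ℝ => f z.1 - z.2 := by fun_prop
  have h2 : MemLp (fun z : EuclideanSpace ℝ (Fin d) × ℝ => f z.1 - z.2) 2 D := by
    rw [memLp_two_iff_integrable_sq hm.aestronglyMeasurable]
    refine (h1.const_mul 2).congr (ae_of_all _ fun z => ?_)
    simp only [sampleLoss]; ring
  have h3 : MemLp (fun z : EuclideanSpace ℝ (Fin d) × ℝ => f z.1) 2 D :=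
    MemLp.of_bound (hf.comp measurable_fst).aestronglyMeasurable K hK
  refine (h3.sub h2).ae_eq (ae_of_all _ fun z => ?_)
  simp

theorem sign_eq_of_abs_sub_lt {a b a' b' : ℝ} (ha : |a' - a| < |a - b| / 2)
    (hb : |b' - b| < |a - b| / 2) : SignType.sign (a' - b') = SignType.sign (a - b) := by
  rw [abs_lt] at ha hb
  rcases lt_trichotomy (a - b) 0 with h | h | h
  · rw [abs_of_neg h] at ha hb
    rw [sign_neg h, sign_neg (by linarith)]
  · rw [h] at ha; simp at ha; linarith
  · rw [abs_of_pos h] at ha hb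
    rw [sign_pos h, sign_pos (by linarith)]

end RandomFeature

theorem mainTheorem1 {d : ℕ} (X : Set (EuclideanSpace ℝ (Fin d))) (hX : IsCompact X)
    (σ : ℝ → ℝ) (hσ : ∃ K : ℝ≥0, LipschitzWith K σ)
    (𝓤 : Measure (EuclideanSpace ℝ (Fin d))) [IsProbabilityMeasure 𝓤]
    (h𝓤 : ∃ r : ℝ, ∀ᵐ u ∂𝓤, ‖u‖ ≤ r)
    (Dval DA DB : Measure (EuclideanSpace ℝ (Fin d) × ℝ))
    (hval : RandomFeature.IsDataDistribution X Dval)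
    (hA : RandomFeature.IsDataDistribution X DA)
    (hB : RandomFeature.IsDataDistribution X DB)
    (fA fB : EuclideanSpace ℝ (Fin d) → ℝ)
    (hfA : RandomFeature.IsNoiseFreeTarget DA fA)
    (hfB : RandomFeature.IsNoiseFreeTarget DB fB)
    (hwA : RandomFeature.IsWellBehaved X σ 𝓤 Dval DA fA)
    (hwB : RandomFeature.IsWellBehaved X σ 𝓤 Dval DB fB)
    (hΔ : RandomFeature.expectedLoss Dval fA - RandomFeature.expectedLoss Dval fB ≠ 0) :
    ∃ (m₀ T₀ : ℕ) (c₀ α ηmax : ℝ), 0 < m₀ ∧ 0 < T₀ ∧ 0 < c₀ ∧ 0 < α ∧ 0 < ηmax ∧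
      ∀ m T B : ℕ, m₀ ≤ m → T₀ ≤ T → 1 ≤ B →
        ∀ η : ℝ, c₀ / (T : ℝ) ≤ η → η ≤ min (α * (B : ℝ) * (m : ℝ)) ηmax →
          SignType.sign (RandomFeature.expectedTrainedLoss σ 𝓤 Dval DA m η B T -
              RandomFeature.expectedTrainedLoss σ 𝓤 Dval DB m η B T) =
            SignType.sign
              (RandomFeature.expectedLoss Dval fA - RandomFeature.expectedLoss Dval fB) := by
  obtain ⟨K, hK⟩ := hσ
  obtain ⟨r, hr⟩ := h𝓤
  have := hval.isProbabilityMeasure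
  obtain ⟨νA, CA, MA, hRA, hfνA⟩ := hwA.exists_isBoundedRealizable hX hK hr hA hfA
  obtain ⟨νB, CB, MB, hRB, hfνB⟩ := hwB.exists_isBoundedRealizable hX hK hr hB hfB
  have hvalX := hval.ae_mem hX.measurableSet
  obtain ⟨κA, hκA⟩ := RandomFeature.exists_inputMarginal_le hX hval hwA.full_support
  obtain ⟨κB, hκB⟩ := RandomFeature.exists_inputMarginal_le hX hval hwB.full_support
  rw [RandomFeature.expectedLoss_congr hvalX hfνA,
    RandomFeature.expectedLoss_congr hvalX hfνB] at hΔ ⊢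
  have hmA := RandomFeature.measurable_infiniteNetwork hRA.measurable_activation
    hRA.measurable_weight 𝓤
  have hmB := RandomFeature.measurable_infiniteNetwork hRB.measurable_activation
    hRB.measurable_weight 𝓤
  set gA := RandomFeature.infiniteNetwork σ 𝓤 νA with hgA
  set gB := RandomFeature.infiniteNetwork σ 𝓤 νB with hgB
  have hbA : ∀ᵐ z ∂Dval, |gA z.1| ≤ CA * MA :=
    hvalX.mono fun z hz => hRA.abs_infiniteNetwork_le hz
  have hbB : ∀ᵐ z ∂Dval, |gB z.1| ≤ CB * MB :=
    hvalX.mono fun z hz => hRB.abs_infiniteNetwork_le hz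
  -- A non-integrable loss would be 0 by convention. As the two target losses differ, at least one
  -- is nonzero, and this forces the validation labels to be square integrable, which makes both
  -- losses meaningful.
  have hy : MemLp (Prod.snd : EuclideanSpace ℝ (Fin d) × ℝ → ℝ) 2 Dval := by
    by_cases h0 : RandomFeature.expectedLoss Dval gA = 0
    · refine RandomFeature.memLp_snd_of_expectedLoss_ne_zero hmB hbB fun h1 => hΔ ?_
      rw [h0, h1, sub_zero]
    · exact RandomFeature.memLp_snd_of_expectedLoss_ne_zero hmA hbA h0
  have hsqA : MemLp (fun z : EuclideanSpace ℝ (Fin d) × ℝ => gA z.1 - z.2) 2 Dval :=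
    (MemLp.of_bound (hmA.comp measurable_fst).aestronglyMeasurable _ hbA).sub hy
  have hsqB : MemLp (fun z : EuclideanSpace ℝ (Fin d) × ℝ => gB z.1 - z.2) 2 Dval :=
    (MemLp.of_bound (hmB.comp measurable_fst).aestronglyMeasurable _ hbB).sub hy
  have hε : 0 < |RandomFeature.expectedLoss Dval gA - RandomFeature.expectedLoss Dval gB| / 2 :=
    half_pos (abs_pos.2 hΔ)
  obtain ⟨δA, hδA, hlossA⟩ := hRA.exists_abs_expectedTrainedLoss_sub_lt hvalX hsqA hκA hε
  obtain ⟨δB, hδB, hlossB⟩ := hRB.exists_abs_expectedTrainedLoss_sub_lt hvalX hsqB hκB hε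
  set δ := min δA δB with hδ
  have hδ0 : 0 < δ := lt_min hδA hδB
  -- The three smallness conditions become m ≥ 1/δ, ηT ≥ c₀ = 1/δ and η ≤ ηmax = δ. The lower bound
  -- on η already encodes that ηT is large, so T₀ = 1 only keeps T positive.
  refine ⟨⌈1 / δ⌉₊ + 1, 1, 1 / δ, 1, δ, Nat.succ_pos _, one_pos, by positivity, one_pos, hδ0, ?_⟩
  intro m T B hm hT hB1 η hη1 hη2
  have hT' : (0 : ℝ) < T := by exact_mod_cast hT
  have hη0 : 0 < η := lt_of_lt_of_le (by positivity) hη1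
  have hηδ : η ≤ δ := hη2.trans (min_le_right _ _)
  have hTδ : 1 / (η * T) ≤ δ := by
    rw [div_le_iff₀ hT'] at hη1
    rw [div_le_comm₀ (by positivity) hδ0]
    exact hη1
  have hm1 : 1 ≤ m := le_trans (Nat.le_add_left 1 _) hm
  have hmδ : 1 / (m : ℝ) ≤ δ := by
    rw [div_le_comm₀ (by exact_mod_cast hm1) hδ0]
    refine (Nat.le_ceil (1 / δ)).trans ?_
    exact_mod_cast (Nat.le_succ _).trans hm
  exact RandomFeature.sign_eq_of_abs_sub_lt
    (hlossA m T B hB1 hT hm1 (hmδ.trans (min_le_left _ _)) η hη0 (hηδ.trans (min_le_left _ _))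
      (hTδ.trans (min_le_left _ _)))
    (hlossB m T B hB1 hT hm1 (hmδ.trans (min_le_right _ _)) η hη0 (hηδ.trans (min_le_right _ _))
      (hTδ.trans (min_le_right _ _)))
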